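/- Let $\mathbb P_d$ be the set of real symmetric positive definite $d\times d$ matrices, with the Frobenius inner product $\langle A,B\rangle=\operatorname{tr}(A^\top B)$, the affine-invariant distance $\delta_R(A,B)=\|\log(A^{-1/2}BA^{-1/2})\|_F$ and the geodesics $\gamma_{A,B}(t)=A^{1/2}(A^{-1/2}BA^{-1/2})^tA^{1/2}$, $0\le t\le 1$. A function $\phi:\mathbb P_d\to\mathbb R$ is \emph{g-convex} if $\phi\circ\gamma_{A,B}$ is convex on $[0,1]$ for all $A,B\in\mathbb P_d$. It is \emph{DC} with decomposition $(f,h)$ if $\phi=f-h$ on $\mathbb P_d$ with $f,h$ convex in the Euclidean sense and $h$ differentiable with locally Lipschitz Euclidean gradient $\nabla h$ (for example $h\in C^2$). The \emph{convex-concave procedure} (CCCP) for $(f,h)$ started at $X_0\in\mathbb P_d$ chooses $$X_{k+1}\in\operatorname*{arg\,min}_{X\in\mathbb P_d}Q(X,X_k),\qquad Q(X,Y)=f(X)-h(Y)-\langle\nabla h(Y),X-Y\rangle .$$ \textbf{(1)} For every $d$ there is a function $\alpha:\mathbb P_d\times\mathbb R\to\mathbb R$ such that the following holds. Let $\hat\phi=\phi+\mathcal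 R$ be a regularized objective on $\mathbb P_d$ that is g-convex and DC with decomposition $(f,h)$, and let $X_0\in\mathbb P_d$ be such that the sublevel set $\mathcal S=\{X\in\mathbb P_d:\hat\phi(X)\le\hat\phi(X_0)\}$ is $\delta_R$-bounded. Then $\hat\phi$ has a global minimizer on $\mathbb P_d$; CCCP iterates from $X_0$ exist; and $\nabla h$ is Lipschitz on the (Euclidean) convex hull of $\mathcal S$. Moreover, for every sequence $(X_k)$ of CCCP iterates from $X_0$: (a) if $X^*$ is a global minimizer of $\hat\phi$, $\delta_R(X,X^*)\le R$ for all $X\in\mathcal S$, and $L\ge0$ is a Lipschitz constant (in the Frobenius norm) of $\nabla h$ on the convex hull of $\mathcal S$, then $$\hat\phi(X_k)-\hat\phi(X^*)\le\frac{2L\,\alpha(X^*,R)^2}{k+2}\qquad\text{for all }k\ge1;$$ (b) the $\delta_R$-distance of $X_k$ to the set of global minimizers of $\hat\phi$ tends to $0$ as $k\to\infty$. \textbf{(2)} Let $S$ be a symmetric positive semidefinite $d\times d$ matrix (such as a sample covariance matrix), $\hat\Sigma,\Sigma_0\in\mathbb P_d$ and $\beta>0$, and suppose that $S\succ0$ or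 $\beta>2$. Let $$\hat\phi(\Sigma)=\operatorname{tr}(S\Sigma^{-1})+\log\det\Sigma+\beta\,\delta_S^2(\Sigma,\hat\Sigma),\qquad \delta_S^2(X,Y)=\log\det\tfrac{X+Y}2-\tfrac12\log\det(XY).$$ Then $\hat\phi$ has a unique minimizer $\Sigma^*$ on $\mathbb P_d$, and: (a) CCCP for the decomposition $f(\Sigma)=\operatorname{tr}(S\Sigma^{-1})-\frac\beta2\log\det(\Sigma\hat\Sigma)$, $h(\Sigma)=-\log\det\Sigma-\beta\log\det\frac{\Sigma+\hat\Sigma}2$ has iterates from $\Sigma_0$, and every such sequence of iterates $\Sigma_k$ converges to $\Sigma^*$ and satisfies $\hat\phi(\Sigma_k)-\hat\phi(\Sigma^*)\le C/(k+2)$ for all $k\ge1$, with $C$ independent of $k$; (b) there is $\bar\eta>0$ such that for every number $L\ge1$ of inner steps and all step sizes $0<\eta_\ell\le\bar\eta$, the iterates defined by $\Sigma_{k,0}=\Sigma_k$, $$\Sigma_{k,\ell+1}=\Sigma_{k,\ell}-\eta_\ell\Big(-\Sigma_{k,\ell}^{-1}S\Sigma_{k,\ell}^{-1}-\tfrac\beta2\Sigma_{k,\ell}^{-1}+\Sigma_k^{-1}+\beta(\Sigma_k+\hat\Sigma)^{-1}\Big)\quad(0\le\ell<L),\qquad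 \Sigma_{k+1}=\Sigma_{k,L},$$ all lie in $\mathbb P_d$, and $\Sigma_{k,\ell}\to\Sigma^*$ as $k\to\infty$ for each $\ell\in\{0,\dots,L\}$; in particular $\Sigma_k\to\Sigma^*$. -/

import Mathlib

open Filter Topology

noncomputable section

namespace SPDCone

/-- Real `d × d` matrices. -/
abbrev Mat (d : ℕ) := Matrix (Fin d) (Fin d) ℝ

/-- The cone of symmetric positive definite matrices. -/
def PD (d : ℕ) : Set (Mat d) := {X | X.PosDef}

/-! ### Geometry of the cone -/

/-- The Frobenius inner product `tr (Aᵀ B)`. -/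
def frobInner {d : ℕ} (A B : Mat d) : ℝ := (A.transpose * B).trace

/-- The Frobenius norm. -/
def frobNorm {d : ℕ} (A : Mat d) : ℝ := Real.sqrt (frobInner A A)

/-- Real power of a symmetric positive definite matrix, by the spectral functional calculus. -/
def mpow {d : ℕ} (A : Mat d) (t : ℝ) : Mat d := cfc (fun x : ℝ => x ^ t) A

/-- Logarithm of a symmetric positive definite matrix, by the spectral functional calculus. -/
def mlog {d : ℕ} (A : Mat d) : Mat d := cfc Real.log A

/-- The affine-invariant geodesic
`γ(t) = A^{1/2} (A^{-1/2} B A^{-1/2})^t A^{1/2}` from `A` to `B`. -/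
def geodesic {d : ℕ} (A B : Mat d) (t : ℝ) : Mat d :=
  mpow A (1 / 2) * mpow (mpow A (-(1 / 2)) * B * mpow A (-(1 / 2))) t * mpow A (1 / 2)

/-- The affine-invariant Riemannian distance `‖log (A^{-1/2} B A^{-1/2})‖_F`. -/
def riemDist {d : ℕ} (A B : Mat d) : ℝ :=
  frobNorm (mlog (mpow A (-(1 / 2)) * B * mpow A (-(1 / 2))))

/-- Geodesic convexity of a real function on the positive definite cone. -/
def GConvex {d : ℕ} (φ : Mat d → ℝ) : Prop :=
  ∀ A ∈ PD d, ∀ B ∈ PD d, ConvexOn ℝ (Set.Icc (0 : ℝ) 1) (fun t => φ (geodesic A B t))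

/-! ### Euclidean gradients -/

/-- `G` is the Euclidean (Frobenius) gradient at `X` of the function `h` on the positive definite
cone, an open subset of the space of symmetric matrices: `G` is symmetric and
`h(Y) = h(X) + ⟨G, Y - X⟩ + o(‖Y - X‖)`. -/
def IsEuclGradAt {d : ℕ} (h : Mat d → ℝ) (G X : Mat d) : Prop :=
  G.IsSymm ∧
    (fun Y => h Y - h X - frobInner G (Y - X)) =o[𝓝[PD d] X] (fun Y => frobNorm (Y - X))

open Classical in
/-- The Euclidean gradient (zero where `h` is not differentiable). -/
def euclGrad {d : ℕ} (h : Mat d → ℝ) (X : Mat d) : Mat d :=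
  if H : ∃ G, IsEuclGradAt h G X then H.choose else 0

/-- The gradient of `h` is Lipschitz with constant `L` on `s`, in the Frobenius norm. -/
def LipschitzGradOn {d : ℕ} (h : Mat d → ℝ) (L : ℝ) (s : Set (Mat d)) : Prop :=
  ∀ X ∈ s, ∀ Y ∈ s, frobNorm (euclGrad h X - euclGrad h Y) ≤ L * frobNorm (X - Y)

/-- `h` is differentiable on the positive definite cone with locally Lipschitz gradient
(every `C²` function is of this kind). -/
def SmoothOnPD {d : ℕ} (h : Mat d → ℝ) : Prop :=
  (∀ X ∈ PD d, ∃ G, IsEuclGradAt h G X) ∧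
    ∀ X ∈ PD d, ∃ r > 0, ∃ L : ℝ, LipschitzGradOn h L {Y ∈ PD d | frobNorm (Y - X) < r}

/-! ### Difference-of-convex structure and the convex-concave procedure -/

/-- The regularized objective `φ + R`. -/
def regularized {d : ℕ} (φ Reg : Mat d → ℝ) (X : Mat d) : ℝ := φ X + Reg X

/-- On the positive definite cone, `φ = f - h` with `f`, `h` Euclidean convex and `h` smooth. -/
structure IsDC {d : ℕ} (φ f h : Mat d → ℝ) : Prop where
  convex_f : ConvexOn ℝ (PD d) f
  convex_h : ConvexOn ℝ (PD d) h
  smooth_h : SmoothOnPD h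
  eq_sub : ∀ X ∈ PD d, φ X = f X - h X

/-- The surrogate `Q(X, Y) = f(X) - h(Y) - ⟨∇h(Y), X - Y⟩`. -/
def surrogate {d : ℕ} (f h : Mat d → ℝ) (X Y : Mat d) : ℝ :=
  f X - h Y - frobInner (euclGrad h Y) (X - Y)

/-- `X` minimizes `φ` over the positive definite cone. -/
def IsMinimizer {d : ℕ} (φ : Mat d → ℝ) (X : Mat d) : Prop :=
  X ∈ PD d ∧ ∀ Y ∈ PD d, φ X ≤ φ Y

/-- `X` is a sequence of iterates of the convex-concave procedure started at `X₀`: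
`X (k+1)` minimizes `Q(·, X k)` over the positive definite cone. -/
def IsCCCP {d : ℕ} (f h : Mat d → ℝ) (X₀ : Mat d) (X : ℕ → Mat d) : Prop :=
  X 0 = X₀ ∧ ∀ k, IsMinimizer (fun Y => surrogate f h Y (X k)) (X (k + 1))

/-- The sublevel set of `φ` through `X₀`. -/
def sublevel {d : ℕ} (φ : Mat d → ℝ) (X₀ : Mat d) : Set (Mat d) := {X ∈ PD d | φ X ≤ φ X₀}

/-! ### The regularized Gaussian optimistic likelihood -/

/-- The S-divergence `log det ((X + Y) / 2) - (1/2) log det (X Y)`. -/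
def sDiv {d : ℕ} (X Y : Mat d) : ℝ :=
  Real.log ((1 / 2 : ℝ) • (X + Y)).det - 1 / 2 * Real.log (X * Y).det

/-- The Gaussian negative log-likelihood `tr (S X⁻¹) + log det X`. -/
def gaussNLL {d : ℕ} (S X : Mat d) : ℝ := (S * X⁻¹).trace + Real.log X.det

/-- The objective `tr (S X⁻¹) + log det X + β δ_S²(X, T)`. -/
def optLik {d : ℕ} (S T : Mat d) (β : ℝ) : Mat d → ℝ :=
  regularized (gaussNLL S) (fun X => β * sDiv X T)

/-- The convex part `f` of `optLik`. -/
def optLikF {d : ℕ} (S T : Mat d) (β : ℝ) (X : Mat d) : ℝ :=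
  (S * X⁻¹).trace - β / 2 * Real.log (X * T).det

/-- The subtracted convex part `h` of `optLik`. -/
def optLikH {d : ℕ} (T : Mat d) (β : ℝ) (X : Mat d) : ℝ :=
  -Real.log X.det - β * Real.log ((1 / 2 : ℝ) • (X + T)).det

/-- Inner loop of the algorithm: gradient steps with step sizes `η` on the surrogate at `Y`,
started at `Y`. -/
def innerIter {d : ℕ} (S T : Mat d) (β : ℝ) (η : ℕ → ℝ) (Y : Mat d) : ℕ → Mat d
  | 0 => Y
  | l + 1 =>
    let X := innerIter S T β η Y l
    X - η l • (-(X⁻¹ * S * X⁻¹) - (β / 2) • X⁻¹ + (Y⁻¹ + β • (Y + T)⁻¹))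

/-- Outer loop of the algorithm, with `L` inner gradient steps per outer iteration. -/
def outerIter {d : ℕ} (S T : Mat d) (β : ℝ) (η : ℕ → ℝ) (L : ℕ) (X₀ : Mat d) : ℕ → Mat d
  | 0 => X₀
  | k + 1 => innerIter S T β η (outerIter S T β η L X₀ k) L

end SPDCone

end

/-! Convergence of the procedure. The surrogate `Q(·, Y)` majorizes the objective with equality at
`Y`, and its excess at `Z` is at most `⟨∇h Z - ∇h Y, Z - Y⟩`, hence at most `L ‖Z - Y‖²`. The
minimizer of `Q(·, X k)` is compared with the point `Z` at time `t` on the geodesic from `X k` to a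
minimizer `Xs`. Geodesic convexity gives `φ Z - φ Xs ≤ (1 - t) (φ (X k) - φ Xs)`, and
`frobNorm_geodesic_sub_le` bounds the Euclidean displacement by `t * s`, where `s` depends only on
`Xs` and `R`. So the gap `Δ` satisfies `Δ (k+1) ≤ (1 - t) Δ k + L s² t²` for all `t` in `[0, 1]`
(`IsCCCP.descent`), and `t = 2 / (k + 2)` yields the rate. Compactness comes from boxes `{A ≥ a, tr
A ≤ b}` with `a > 0`: they are compact, convex, contained in the cone, and contain every
`riemDist`-bounded set. The likelihood. Subgradient inequalities for `f` and `h` with explicit,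
locally Lipschitz subgradients give convexity and differentiability together. Expanding `det
(diagonal x + N)` with positive coefficients makes the objective along a geodesic a sum of
exponentials, a linear term and a log-sum-exp (`exists_optLik_geodesic`); this gives geodesic
convexity and, from the equality case, uniqueness. Coercivity reduces to a scalar estimate for each
eigenvalue. Inexact inner loop. A short gradient step decreases the surrogate, and the first inner
step is a step along the gradient of the full objective, so these gradients tend to zero along the
outer iterates. The gradient bounds the optimality gap (`sub_le_frobNorm_grad_mul`), so the values
converge, and uniqueness gives convergence of the iterates. -/

open Filter Topology

namespace SPDCone

variable {d : ℕ}

/-! ### Frobenius inner product and norm -/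

section Frobenius

open scoped Matrix.Norms.Frobenius in
lemma frobNorm_eq_norm (A : Mat d) : frobNorm A = ‖A‖ := by
  rw [Matrix.frobenius_norm_def]
  simp only [frobNorm, frobInner, Matrix.trace, Matrix.mul_apply, Matrix.diag_apply,
    Matrix.transpose_apply, Real.norm_eq_abs, Real.rpow_two, sq_abs]
  rw [Finset.sum_comm, Real.sqrt_eq_rpow]
  simp [sq]

lemma frobInner_eq_sum (A B : Mat d) : frobInner A B = ∑ i, ∑ j, A i j * B i j := by
  simp only [frobInner, Matrix.trace, Matrix.mul_apply, Matrix.diag_apply, Matrix.transpose_apply]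
  exact Finset.sum_comm

lemma frobInner_add_left (A B C : Mat d) :
    frobInner (A + B) C = frobInner A C + frobInner B C := by
  simp [frobInner, Matrix.add_mul]

lemma frobInner_sub_left (A B C : Mat d) :
    frobInner (A - B) C = frobInner A C - frobInner B C := by
  simp [frobInner, Matrix.sub_mul]

lemma frobInner_neg_left (A C : Mat d) : frobInner (-A) C = -frobInner A C := by
  simp [frobInner]

lemma frobInner_smul_left (c : ℝ) (A C : Mat d) : frobInner (c • A) C = c * frobInner A C := by
  simp [frobInner]

lemma frobInner_add_right (A B C : Mat d) :
    frobInner A (B + C) = frobInner A B + frobInner A C := by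
  simp [frobInner, Matrix.mul_add]

lemma frobInner_sub_right (A B C : Mat d) :
    frobInner A (B - C) = frobInner A B - frobInner A C := by
  simp [frobInner, Matrix.mul_sub]

lemma frobInner_neg_right (A C : Mat d) : frobInner A (-C) = -frobInner A C := by
  simp [frobInner]

lemma frobInner_smul_right (c : ℝ) (A C : Mat d) : frobInner A (c • C) = c * frobInner A C := by
  simp [frobInner]

lemma frobInner_zero_right (A : Mat d) : frobInner A 0 = 0 := by
  simp [frobInner]

lemma frobInner_self_nonneg (A : Mat d) : 0 ≤ frobInner A A := by
  rw [frobInner_eq_sum]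
  exact Finset.sum_nonneg fun i _ => Finset.sum_nonneg fun j _ => mul_self_nonneg _

lemma frobNorm_sq (A : Mat d) : frobNorm A ^ 2 = frobInner A A :=
  Real.sq_sqrt (frobInner_self_nonneg A)

lemma frobNorm_nonneg (A : Mat d) : 0 ≤ frobNorm A := Real.sqrt_nonneg _

lemma frobInner_le (A B : Mat d) : |frobInner A B| ≤ frobNorm A * frobNorm B := by
  rw [frobNorm, frobNorm, ← Real.sqrt_mul (frobInner_self_nonneg A)]
  apply Real.abs_le_sqrt
  simp only [frobInner_eq_sum, ← Finset.sum_product', Finset.univ_product_univ]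
  simpa only [sq] using Finset.sum_mul_sq_le_sq_mul_sq Finset.univ
    (fun p : Fin d × Fin d => A p.1 p.2) (fun p => B p.1 p.2)

open scoped Matrix.Norms.Frobenius in
lemma frobNorm_add_le (A B : Mat d) : frobNorm (A + B) ≤ frobNorm A + frobNorm B := by
  simp only [frobNorm_eq_norm]; exact norm_add_le _ _

open scoped Matrix.Norms.Frobenius in
lemma frobNorm_sub_le (A B : Mat d) : frobNorm (A - B) ≤ frobNorm A + frobNorm B := by
  simp only [frobNorm_eq_norm]; exact norm_sub_le _ _

open scoped Matrix.Norms.Frobenius in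
lemma frobNorm_sub_comm (A B : Mat d) : frobNorm (A - B) = frobNorm (B - A) := by
  simp only [frobNorm_eq_norm]; exact norm_sub_rev _ _

open scoped Matrix.Norms.Frobenius in
lemma frobNorm_neg (A : Mat d) : frobNorm (-A) = frobNorm A := by
  simp only [frobNorm_eq_norm]; exact norm_neg _

open scoped Matrix.Norms.Frobenius in
lemma frobNorm_smul (c : ℝ) (A : Mat d) : frobNorm (c • A) = |c| * frobNorm A := by
  simp only [frobNorm_eq_norm]; exact norm_smul _ _

lemma frobNorm_mul_le (A B : Mat d) : frobNorm (A * B) ≤ frobNorm A * frobNorm B := by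
  simp only [frobNorm_eq_norm]; exact Matrix.frobenius_norm_mul _ _

lemma frobNorm_mul_mul_le (A B C : Mat d) :
    frobNorm (A * B * C) ≤ frobNorm A * frobNorm B * frobNorm C :=
  (frobNorm_mul_le _ _).trans (mul_le_mul_of_nonneg_right (frobNorm_mul_le _ _) (frobNorm_nonneg _))

lemma frobNorm_transpose (A : Mat d) : frobNorm A.transpose = frobNorm A := by
  simp only [frobNorm_eq_norm]; exact Matrix.frobenius_norm_transpose _

lemma frobNorm_zero : frobNorm (0 : Mat d) = 0 := by
  simp [frobNorm, frobInner]

lemma abs_apply_le_frobNorm (A : Mat d) (i j : Fin d) : |A i j| ≤ frobNorm A := by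
  apply Real.abs_le_sqrt
  rw [frobInner_eq_sum, sq]
  refine le_trans ?_ (Finset.single_le_sum (f := fun i => ∑ j, A i j * A i j)
    (fun i _ => Finset.sum_nonneg fun j _ => mul_self_nonneg _) (Finset.mem_univ i))
  exact Finset.single_le_sum (f := fun j => A i j * A i j)
    (fun j _ => mul_self_nonneg _) (Finset.mem_univ j)

lemma eq_zero_of_frobNorm_eq_zero {A : Mat d} (h : frobNorm A = 0) : A = 0 := by
  ext i j
  have := abs_apply_le_frobNorm A i j
  rw [h] at this
  exact abs_eq_zero.1 (le_antisymm this (abs_nonneg _))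

lemma continuous_frobInner_right (G : Mat d) : Continuous fun X : Mat d => frobInner G X := by
  unfold frobInner
  fun_prop

lemma continuous_frobNorm : Continuous fun X : Mat d => frobNorm X := by
  unfold frobNorm frobInner
  fun_prop

/-- The topology on `Mat d` is the entrywise one, and every entry is bounded by the Frobenius norm.
-/
lemma tendsto_of_frobNorm {ι : Type*} {l : Filter ι} {u : ι → Mat d} {X : Mat d}
    (h : Tendsto (fun k => frobNorm (u k - X)) l (𝓝 0)) : Tendsto u l (𝓝 X) := by
  refine tendsto_pi_nhds.2 fun i => tendsto_pi_nhds.2 fun j => ?_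
  rw [tendsto_iff_norm_sub_tendsto_zero]
  exact squeeze_zero (fun _ => norm_nonneg _) (fun k => abs_apply_le_frobNorm (u k - X) i j) h

lemma tendsto_frobNorm_sub (X : Mat d) : Tendsto (fun Y => frobNorm (Y - X)) (𝓝 X) (𝓝 0) := by
  have : Continuous fun Y : Mat d => frobNorm (Y - X) :=
    continuous_frobNorm.comp (continuous_id.sub continuous_const)
  simpa [frobNorm_zero] using this.tendsto X

lemma frobNorm_mul_transpose_self (W : Mat d) : frobNorm W ^ 2 = (W * W.transpose).trace := by
  rw [frobNorm_sq, frobInner, Matrix.trace_mul_comm]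

lemma frobNorm_diagonal_le {v : Fin d → ℝ} {c : ℝ} (hc : 0 ≤ c) (hv : ∀ i, |v i| ≤ c) :
    frobNorm (Matrix.diagonal v) ≤ d * c := by
  have h1 : frobInner (Matrix.diagonal v) (Matrix.diagonal v) = ∑ i, v i ^ 2 := by
    simp [frobInner, Matrix.trace, sq]
  rw [frobNorm, h1]
  apply Real.sqrt_le_iff.2
  refine ⟨by positivity, ?_⟩
  calc ∑ i, v i ^ 2 ≤ ∑ _i : Fin d, c ^ 2 :=
        Finset.sum_le_sum fun i _ => sq_le_sq' (abs_le.1 (hv i)).1 (abs_le.1 (hv i)).2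
    _ = d * c ^ 2 := by simp
    _ ≤ (d * c) ^ 2 := by
      rw [mul_pow]
      gcongr
      exact_mod_cast Nat.le_self_pow two_ne_zero d

end Frobenius

/-! ### Diagonalization, matrix powers and simultaneous congruence -/

section Spectral

/-- Orthogonal diagonalization, simultaneously for all functions of a symmetric matrix. -/
lemma exists_diagonalization {M : Mat d} (hM : M.IsHermitian) :
    ∃ (U : Mat d) (v : Fin d → ℝ), U.transpose * U = 1 ∧ U * U.transpose = 1 ∧
      (M = U * Matrix.diagonal v * U.transpose) ∧
      ∀ f : ℝ → ℝ, cfc f M = U * Matrix.diagonal (fun i => f (v i)) * U.transpose := by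
  have key : ∀ f : ℝ → ℝ, cfc f M = (hM.eigenvectorUnitary : Mat d) *
      Matrix.diagonal (fun i => f (hM.eigenvalues i)) *
        (hM.eigenvectorUnitary : Mat d).transpose := by
    intro f
    rw [hM.cfc_eq, Matrix.IsHermitian.cfc, Unitary.conjStarAlgAut_apply]
    rfl
  refine ⟨hM.eigenvectorUnitary, hM.eigenvalues, ?_, ?_, ?_, key⟩
  · exact Unitary.coe_star_mul_self hM.eigenvectorUnitary
  · exact Unitary.coe_mul_star_self hM.eigenvectorUnitary
  · rw [← key fun x => x]
    exact (cfc_id' ℝ M hM).symm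

/-- `U` is only assumed invertible, so this serves orthogonal diagonalizations and congruences
alike. -/
lemma posDef_mul_diagonal_mul_transpose {U Ui : Mat d} (hU : Ui * U = 1) {v : Fin d → ℝ}
    (hv : ∀ i, 0 < v i) : (U * Matrix.diagonal v * U.transpose).PosDef := by
  have hU' : U * Ui = 1 := mul_eq_one_comm.1 hU
  have hu : IsUnit U := IsUnit.of_mul_eq_one _ hU'
  exact (Matrix.IsUnit.posDef_star_right_conjugate_iff hu).2 (Matrix.PosDef.diagonal hv)

lemma pos_of_posDef_mul_diagonal_mul_transpose {U Ui : Mat d} (hU : Ui * U = 1) {v : Fin d → ℝ}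
    (h : (U * Matrix.diagonal v * U.transpose).PosDef) (i : Fin d) : 0 < v i := by
  have hU' : U * Ui = 1 := mul_eq_one_comm.1 hU
  have hu : IsUnit U := IsUnit.of_mul_eq_one _ hU'
  exact Matrix.posDef_diagonal_iff.1 ((Matrix.IsUnit.posDef_star_right_conjugate_iff hu).1 h) i

lemma exists_diagonalization_of_posDef {M : Mat d} (hM : M.PosDef) :
    ∃ (U : Mat d) (v : Fin d → ℝ), U.transpose * U = 1 ∧ U * U.transpose = 1 ∧ (∀ i, 0 < v i) ∧
      (M = U * Matrix.diagonal v * U.transpose) ∧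
      ∀ f : ℝ → ℝ, cfc f M = U * Matrix.diagonal (fun i => f (v i)) * U.transpose := by
  obtain ⟨U, v, h1, h2, h3, h4⟩ := exists_diagonalization hM.1
  exact ⟨U, v, h1, h2, pos_of_posDef_mul_diagonal_mul_transpose h1 (h3 ▸ hM), h3, h4⟩

lemma mul_diagonal_mul_mul {U Ui V : Mat d} (h : Ui * U = 1) (v w : Fin d → ℝ) :
    U * Matrix.diagonal v * Ui * (U * Matrix.diagonal w * V) =
      U * Matrix.diagonal (fun i => v i * w i) * V := by
  calc _ = U * Matrix.diagonal v * (Ui * U) * Matrix.diagonal w * V := by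
        simp only [Matrix.mul_assoc]
    _ = _ := by rw [h, Matrix.mul_one, Matrix.mul_assoc U, Matrix.diagonal_mul_diagonal]

lemma posDef_mpow {A : Mat d} (hA : A.PosDef) (t : ℝ) : (mpow A t).PosDef := by
  obtain ⟨U, v, h1, h2, h3, -, h4⟩ := exists_diagonalization_of_posDef hA
  rw [mpow, h4]
  exact posDef_mul_diagonal_mul_transpose h1 fun i => Real.rpow_pos_of_pos (h3 i) t

lemma mpow_mul_mpow {A : Mat d} (hA : A.PosDef) (s t : ℝ) :
    mpow A s * mpow A t = mpow A (s + t) := by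
  obtain ⟨U, v, h1, h2, h3, -, h4⟩ := exists_diagonalization_of_posDef hA
  simp only [mpow, h4]
  rw [mul_diagonal_mul_mul h1]
  simp only [Real.rpow_add (h3 _)]

lemma mpow_one {A : Mat d} (hA : A.PosDef) : mpow A 1 = A := by
  obtain ⟨U, v, h1, h2, h3, h5, h4⟩ := exists_diagonalization_of_posDef hA
  rw [mpow, h4]
  simp only [Real.rpow_one]
  exact h5.symm

lemma mpow_zero {A : Mat d} (hA : A.PosDef) : mpow A 0 = 1 := by
  obtain ⟨U, v, h1, h2, h3, h5, h4⟩ := exists_diagonalization_of_posDef hA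
  rw [mpow, h4]
  simp only [Real.rpow_zero]
  rw [Matrix.diagonal_one, Matrix.mul_one, h2]

/-- Simultaneous diagonalization of two positive definite matrices by congruence. It computes
geodesics and distances. -/
lemma exists_congruence {A B : Mat d} (hA : A ∈ PD d) (hB : B ∈ PD d) :
    ∃ (W Wi : Mat d) (v : Fin d → ℝ), Wi * W = 1 ∧ W * Wi = 1 ∧ (∀ i, 0 < v i) ∧
      A = W * W.transpose ∧ B = W * Matrix.diagonal v * W.transpose ∧
      (∀ t, geodesic A B t = W * Matrix.diagonal (fun i => v i ^ t) * W.transpose) ∧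
      riemDist A B = Real.sqrt (∑ i, Real.log (v i) ^ 2) := by
  have hA' : A.PosDef := hA
  have hB' : B.PosDef := hB
  set P := mpow A (1 / 2) with hP
  set Q := mpow A (-(1 / 2)) with hQ
  have hPd : P.PosDef := posDef_mpow hA' _
  have hQd : Q.PosDef := posDef_mpow hA' _
  have hPt : P.transpose = P := hPd.1
  have hQt : Q.transpose = Q := hQd.1
  have hPQ : P * Q = 1 := by rw [hP, hQ, mpow_mul_mpow hA', add_neg_cancel, mpow_zero hA']
  have hQP : Q * P = 1 := mul_eq_one_comm.1 hPQ
  have hPP : P * P = A := by rw [hP, mpow_mul_mpow hA', add_halves, mpow_one hA']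
  have hM : (Q * B * Q).PosDef := by
    have hu : IsUnit Q := IsUnit.of_mul_eq_one _ hQP
    have := (Matrix.IsUnit.posDef_star_right_conjugate_iff hu).2 hB'
    rwa [show star Q = Q from hQd.1] at this
  obtain ⟨U, v, h1, h2, h3, h5, h4⟩ := exists_diagonalization_of_posDef hM
  have hgeo : ∀ f : ℝ → ℝ, P * cfc f (Q * B * Q) * P =
      P * U * Matrix.diagonal (fun i => f (v i)) * (P * U).transpose := by
    intro f
    rw [h4, Matrix.transpose_mul, hPt]
    simp only [Matrix.mul_assoc]
  -- With `U` diagonalizing `A^{-1/2} B A^{-1/2}`, the choice `W = A^{1/2} U` turns every function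
  -- of that matrix, multiplied by `A^{1/2}` on both sides, into `W` times a diagonal times its
  -- transpose.
  refine ⟨P * U, U.transpose * Q, v, ?_, ?_, h3, ?_, ?_, fun t => ?_, ?_⟩
  · calc _ = U.transpose * (Q * P) * U := by simp only [Matrix.mul_assoc]
      _ = 1 := by rw [hQP, Matrix.mul_one, h1]
  · calc _ = P * (U * U.transpose) * Q := by simp only [Matrix.mul_assoc]
      _ = 1 := by rw [h2, Matrix.mul_one, hPQ]
  · rw [Matrix.transpose_mul, hPt]
    calc A = P * (U * U.transpose) * P := by rw [h2, Matrix.mul_one, hPP]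
      _ = _ := by simp only [Matrix.mul_assoc]
  · rw [Matrix.transpose_mul, hPt]
    calc B = (P * Q) * B * (Q * P) := by rw [hPQ, hQP, Matrix.one_mul, Matrix.mul_one]
      _ = P * (Q * B * Q) * P := by simp only [Matrix.mul_assoc]
      _ = _ := by rw [h5]; simp only [Matrix.mul_assoc]
  · exact hgeo _
  · have ht : (U * Matrix.diagonal (fun i => Real.log (v i)) * U.transpose).transpose =
        U * Matrix.diagonal (fun i => Real.log (v i)) * U.transpose := by
      simp [Matrix.mul_assoc]
    rw [riemDist, mlog, ← hQ, h4, frobNorm, frobInner, ht, mul_diagonal_mul_mul h1,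
      Matrix.mul_assoc, Matrix.trace_mul_comm, Matrix.mul_assoc, h1, Matrix.mul_one,
      Matrix.trace_diagonal]
    simp only [sq]

end Spectral

/-! ### Loewner order and compact boxes -/

section Order

lemma posSemidef_mul_diagonal_mul_transpose_iff {U Ui : Mat d} (hU : Ui * U = 1)
    {v : Fin d → ℝ} : (U * Matrix.diagonal v * U.transpose).PosSemidef ↔ ∀ i, 0 ≤ v i := by
  have hU' : U * Ui = 1 := mul_eq_one_comm.1 hU
  have hu : IsUnit U := IsUnit.of_mul_eq_one _ hU'
  exact (Matrix.IsUnit.posSemidef_star_right_conjugate_iff hu).trans Matrix.posSemidef_diagonal_iff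

lemma frobNorm_sq_mul_diagonal_mul_transpose {U : Mat d} (hU : U.transpose * U = 1)
    (v : Fin d → ℝ) : frobNorm (U * Matrix.diagonal v * U.transpose) ^ 2 = ∑ i, v i ^ 2 := by
  have ht : (U * Matrix.diagonal v * U.transpose).transpose =
      U * Matrix.diagonal v * U.transpose := by
    simp [Matrix.mul_assoc]
  rw [frobNorm_sq, frobInner, ht, mul_diagonal_mul_mul hU, Matrix.mul_assoc,
    Matrix.trace_mul_comm, Matrix.mul_assoc, hU, Matrix.mul_one, Matrix.trace_diagonal]
  simp only [sq]

lemma trace_mul_diagonal_mul_transpose {U : Mat d} (hU : U.transpose * U = 1)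
    (v : Fin d → ℝ) : (U * Matrix.diagonal v * U.transpose).trace = ∑ i, v i := by
  rw [Matrix.mul_assoc, Matrix.trace_mul_comm, Matrix.mul_assoc, hU, Matrix.mul_one,
    Matrix.trace_diagonal]

lemma mul_diagonal_const_mul_transpose {U : Mat d} (hU : U * U.transpose = 1) (c : ℝ) :
    U * Matrix.diagonal (fun _ => c) * U.transpose = c • (1 : Mat d) := by
  rw [← Matrix.smul_one_eq_diagonal]
  simp [hU]

lemma mul_diagonal_mul_transpose_sub {U : Mat d} (v w : Fin d → ℝ) :
    U * Matrix.diagonal v * U.transpose - U * Matrix.diagonal w * U.transpose =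
      U * Matrix.diagonal (fun i => v i - w i) * U.transpose := by
  rw [← Matrix.sub_mul, ← Matrix.mul_sub, Matrix.diagonal_sub]

lemma mul_diagonal_mul_transpose_add {U : Mat d} (v w : Fin d → ℝ) :
    U * Matrix.diagonal v * U.transpose + U * Matrix.diagonal w * U.transpose =
      U * Matrix.diagonal (fun i => v i + w i) * U.transpose := by
  rw [← Matrix.add_mul, ← Matrix.mul_add, Matrix.diagonal_add]

lemma frobNorm_le_trace {A : Mat d} (hA : A.PosSemidef) : frobNorm A ≤ A.trace := by
  obtain ⟨U, v, h1, h2, h3, -⟩ := exists_diagonalization hA.1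
  rw [h3] at hA
  have hv := (posSemidef_mul_diagonal_mul_transpose_iff h1).1 hA
  rw [h3]
  refine abs_le_of_sq_le_sq' ?_ hA.trace_nonneg |>.2
  rw [frobNorm_sq_mul_diagonal_mul_transpose h1, trace_mul_diagonal_mul_transpose h1]
  exact Finset.sum_sq_le_sq_sum_of_nonneg fun i _ => hv i

lemma abs_trace_le (A : Mat d) : |A.trace| ≤ d * frobNorm A := by
  calc |A.trace| ≤ ∑ i, |A i i| := Finset.abs_sum_le_sum_abs _ _
    _ ≤ ∑ _i : Fin d, frobNorm A := Finset.sum_le_sum fun i _ => abs_apply_le_frobNorm A i i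
    _ = d * frobNorm A := by simp

/-- Each eigenvalue of a symmetric matrix is bounded in modulus by the Frobenius norm. -/
lemma posSemidef_frobNorm_smul_one_add {Z : Mat d} (hZ : Z.IsSymm) {c : ℝ} (hc : frobNorm Z ≤ c) :
    (c • (1 : Mat d) + Z).PosSemidef := by
  obtain ⟨U, v, h1, h2, h3, -⟩ := exists_diagonalization (M := Z) hZ
  rw [h3, ← mul_diagonal_const_mul_transpose h2 c, mul_diagonal_mul_transpose_add,
    posSemidef_mul_diagonal_mul_transpose_iff h1]
  intro i
  have h5 : v i ^ 2 ≤ frobNorm Z ^ 2 := by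
    rw [h3, frobNorm_sq_mul_diagonal_mul_transpose h1]
    exact Finset.single_le_sum (f := fun i => v i ^ 2) (fun i _ => sq_nonneg _) (Finset.mem_univ i)
  have := abs_le_of_sq_le_sq' h5 (frobNorm_nonneg Z)
  linarith [this.1]

lemma exists_pos_posSemidef_sub {B : Mat d} (hB : B.PosDef) :
    ∃ a : ℝ, 0 < a ∧ (B - a • (1 : Mat d)).PosSemidef := by
  obtain ⟨U, v, h1, h2, h3, h5, -⟩ := exists_diagonalization_of_posDef hB
  -- The reciprocal of `1 + ∑ (v i)⁻¹` is positive and below every eigenvalue; unlike the smallest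
  -- eigenvalue, it also makes sense for `d = 0`.
  have hs : 0 ≤ ∑ i, (v i)⁻¹ := Finset.sum_nonneg fun i _ => (inv_pos.2 (h3 i)).le
  refine ⟨(1 + ∑ i, (v i)⁻¹)⁻¹, by positivity, ?_⟩
  rw [h5, ← mul_diagonal_const_mul_transpose h2, mul_diagonal_mul_transpose_sub,
    posSemidef_mul_diagonal_mul_transpose_iff h1]
  intro i
  have h6 : (v i)⁻¹ ≤ ∑ i, (v i)⁻¹ :=
    Finset.single_le_sum (f := fun i => (v i)⁻¹) (fun i _ => (inv_pos.2 (h3 i)).le)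
      (Finset.mem_univ i)
  rw [sub_nonneg]
  exact inv_le_of_inv_le₀ (h3 i) (by linarith)

/-- Matrices bounded below by `a • 1` with trace at most `b`. -/
def box (d : ℕ) (a b : ℝ) : Set (Mat d) := {A | (A - a • (1 : Mat d)).PosSemidef ∧ A.trace ≤ b}

lemma box_subset_PD {a b : ℝ} (ha : 0 < a) : box d a b ⊆ PD d := by
  rintro A ⟨hA, -⟩
  have := (Matrix.PosDef.one.smul ha).add_posSemidef hA
  simpa [PD] using this

lemma posSemidef_of_mem_box {a b : ℝ} (ha : 0 ≤ a) {A : Mat d} (hA : A ∈ box d a b) :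
    A.PosSemidef := by
  have := hA.1.add (Matrix.PosSemidef.one.smul ha)
  simpa using this

lemma convex_PD : Convex ℝ (PD d) := by
  intro A hA B hB s t hs ht hst
  have hA' : A.PosDef := hA
  have hB' : B.PosDef := hB
  rcases hs.eq_or_lt with rfl | hs
  · rw [zero_add] at hst
    simpa [hst] using hB
  · exact (hA'.smul hs).add_posSemidef (hB'.posSemidef.smul ht)

lemma convex_box (a b : ℝ) : Convex ℝ (box d a b) := by
  intro A hA B hB s t hs ht hst
  refine ⟨?_, ?_⟩
  · have h := (hA.1.smul hs).add (hB.1.smul ht)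
    convert h using 1
    rw [smul_sub, smul_sub, smul_smul, smul_smul, sub_add_sub_comm, ← add_smul, ← add_mul, hst,
      one_mul]
  · rw [Matrix.trace_add, Matrix.trace_smul, Matrix.trace_smul, smul_eq_mul, smul_eq_mul]
    calc s * A.trace + t * B.trace ≤ s * b + t * b := by
          gcongr
          exacts [hA.2, hB.2]
      _ = b := by rw [← add_mul, hst, one_mul]

lemma isClosed_posSemidef : IsClosed {A : Mat d | A.PosSemidef} := by
  have : {A : Mat d | A.PosSemidef} = {A : Mat d | A.transpose = A} ∩
      ⋂ x : Fin d → ℝ, {A | 0 ≤ x ⬝ᵥ A.mulVec x} := by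
    ext A
    simp only [Set.mem_ofPred_eq, Set.mem_inter_iff, Set.mem_iInter]
    constructor
    · exact fun h => ⟨h.1, fun x => h.dotProduct_mulVec_nonneg x⟩
    · exact fun h => .of_dotProduct_mulVec_nonneg h.1 fun x => h.2 x
  rw [this]
  refine (isClosed_eq (by fun_prop) continuous_id).inter (isClosed_iInter fun x => ?_)
  exact isClosed_le continuous_const (by fun_prop)

/-- The box is closed, and its entries are bounded because `|A i j| ≤ ‖A‖ ≤ tr A ≤ b` for positive
semidefinite `A`. -/
lemma isCompact_box {a b : ℝ} (ha : 0 ≤ a) : IsCompact (box d a b) := by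
  have h1 : IsCompact (Set.univ.pi fun _ : Fin d => Set.univ.pi fun _ : Fin d => Set.Icc (-b) b) :=
    isCompact_univ_pi fun _ => isCompact_univ_pi fun _ => isCompact_Icc
  refine IsCompact.of_isClosed_subset (s := ({A : Mat d | ∀ i j, A i j ∈ Set.Icc (-b) b})) ?_ ?_ ?_
  · have h2 : ({A : Mat d | ∀ i j, A i j ∈ Set.Icc (-b) b}) =
        (Set.univ.pi fun _ : Fin d => Set.univ.pi fun _ : Fin d => Set.Icc (-b) b) :=
      Set.ext fun A => ⟨fun h i _ j _ => h i j, fun h i j => h i trivial j trivial⟩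
    rw [h2]
    exact h1
  · refine IsClosed.inter (s₁ := {A | (A - a • (1 : Mat d)).PosSemidef})
      (s₂ := {A | A.trace ≤ b}) ?_ ?_
    · exact isClosed_posSemidef.preimage (f := fun A : Mat d => A - a • (1 : Mat d)) (by fun_prop)
    · exact isClosed_le (by fun_prop) continuous_const
  · intro A hA i j
    exact abs_le.1 ((abs_apply_le_frobNorm A i j).trans
      ((frobNorm_le_trace (posSemidef_of_mem_box ha hA)).trans hA.2))

lemma frobNorm_inv_le {a b : ℝ} (ha : 0 < a) {A : Mat d} (hA : A ∈ box d a b) :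
    frobNorm A⁻¹ ≤ d / a := by
  have hA' : A.PosDef := box_subset_PD ha hA
  obtain ⟨U, v, h1, h2, h3, h5, -⟩ := exists_diagonalization_of_posDef hA'
  have hv : ∀ i, a ≤ v i := by
    have h := hA.1
    rw [h5, ← mul_diagonal_const_mul_transpose h2, mul_diagonal_mul_transpose_sub,
      posSemidef_mul_diagonal_mul_transpose_iff h1] at h
    exact fun i => sub_nonneg.1 (h i)
  have hinv : A⁻¹ = U * Matrix.diagonal (fun i => (v i)⁻¹) * U.transpose := by
    apply Matrix.inv_eq_right_inv
    rw [h5, mul_diagonal_mul_mul h1]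
    simp only [mul_inv_cancel₀ (h3 _).ne', mul_diagonal_const_mul_transpose h2, one_smul]
  refine abs_le_of_sq_le_sq' ?_ (by positivity) |>.2
  rw [hinv, frobNorm_sq_mul_diagonal_mul_transpose h1]
  calc ∑ i, (v i)⁻¹ ^ 2 ≤ ∑ _i : Fin d, a⁻¹ ^ 2 := Finset.sum_le_sum fun i _ =>
        pow_le_pow_left₀ (inv_pos.2 (h3 i)).le (inv_anti₀ ha (hv i)) 2
    _ = d * a⁻¹ ^ 2 := by simp
    _ ≤ (d / a) ^ 2 := by
      rw [div_eq_mul_inv, mul_pow]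
      gcongr
      exact_mod_cast Nat.le_self_pow two_ne_zero d

lemma add_mem_box {a b c : ℝ} {A Z : Mat d} (hA : A ∈ box d a b) (hZ : Z.IsSymm)
    (hc : frobNorm Z ≤ c) : A + Z ∈ box d (a - c) (b + d * c) := by
  refine ⟨?_, ?_⟩
  · have := hA.1.add (posSemidef_frobNorm_smul_one_add hZ hc)
    convert this using 1
    rw [sub_smul]
    abel
  · rw [Matrix.trace_add]
    have h1 := (abs_le.1 (abs_trace_le Z)).2
    have h2 : (d : ℝ) * frobNorm Z ≤ d * c := by gcongr
    linarith [hA.2]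

lemma box_mono {a b a' b' : ℝ} (ha : a' ≤ a) (hb : b ≤ b') : box d a b ⊆ box d a' b' := by
  rintro A ⟨h1, h2⟩
  refine ⟨?_, h2.trans hb⟩
  have := h1.add (Matrix.PosSemidef.one.smul (sub_nonneg.2 ha))
  convert this using 1
  rw [sub_smul]
  abel

lemma exists_mem_box {A : Mat d} (hA : A ∈ PD d) : ∃ a b : ℝ, 0 < a ∧ A ∈ box d a b := by
  obtain ⟨a, ha, h⟩ := exists_pos_posSemidef_sub (B := A) hA
  exact ⟨a, A.trace, ha, h, le_rfl⟩

/-- Positive definite matrices near a positive definite matrix lie in a common box. -/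
lemma exists_ball_subset_box {A : Mat d} (hA : A ∈ PD d) :
    ∃ r a b : ℝ, 0 < r ∧ 0 < a ∧ ∀ Y : Mat d, Y.IsSymm → frobNorm (Y - A) ≤ r → Y ∈ box d a b := by
  obtain ⟨a, b, ha, h⟩ := exists_mem_box hA
  refine ⟨a / 2, a - a / 2, b + d * (a / 2), by positivity, by linarith, fun Y hY hYr => ?_⟩
  have hs : (Y - A).IsSymm := hY.sub (Matrix.PosDef.isHermitian (M := A) hA)
  have := add_mem_box h hs hYr
  rwa [add_sub_cancel] at this

end Order

/-! ### Comparison of Riemannian and Euclidean geometry -/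

section Geometry

lemma inv_congruence {W Wi : Mat d} (h1 : Wi * W = 1) (h2 : W * Wi = 1) {v : Fin d → ℝ}
    (hv : ∀ i, 0 < v i) : (W * Matrix.diagonal v * W.transpose)⁻¹ =
      Wi.transpose * Matrix.diagonal (fun i => (v i)⁻¹) * Wi := by
  apply Matrix.inv_eq_right_inv
  calc _ = W * Matrix.diagonal v * (Wi * W).transpose *
          Matrix.diagonal (fun i => (v i)⁻¹) * Wi := by
        rw [Matrix.transpose_mul]; simp only [Matrix.mul_assoc]
    _ = 1 := by
        rw [h1, Matrix.transpose_one, Matrix.mul_one, Matrix.mul_assoc W,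
          Matrix.diagonal_mul_diagonal]
        simp [mul_inv_cancel₀ (hv _).ne', h2]

lemma inv_mul_transpose_self {W Wi : Mat d} (h1 : Wi * W = 1) (h2 : W * Wi = 1) :
    (W * W.transpose)⁻¹ = Wi.transpose * Wi := by
  simpa using inv_congruence h1 h2 fun _ => one_pos

lemma geodesic_mem {A B : Mat d} (hA : A ∈ PD d) (hB : B ∈ PD d) (t : ℝ) :
    geodesic A B t ∈ PD d := by
  obtain ⟨W, Wi, v, h1, h2, hv, hWA, hWB, hg, -⟩ := exists_congruence hA hB
  rw [hg]
  exact posDef_mul_diagonal_mul_transpose h1 fun i => Real.rpow_pos_of_pos (hv i) t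

lemma geodesic_zero {A B : Mat d} (hA : A ∈ PD d) (hB : B ∈ PD d) : geodesic A B 0 = A := by
  obtain ⟨W, Wi, v, h1, h2, hv, hWA, hWB, hg, -⟩ := exists_congruence hA hB
  rw [hg]
  simp only [Real.rpow_zero, Matrix.diagonal_one, Matrix.mul_one, ← hWA]

lemma geodesic_one {A B : Mat d} (hA : A ∈ PD d) (hB : B ∈ PD d) : geodesic A B 1 = B := by
  obtain ⟨W, Wi, v, h1, h2, hv, hWA, hWB, hg, -⟩ := exists_congruence hA hB
  rw [hg]
  simp only [Real.rpow_one, ← hWB]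

lemma abs_le_sqrt_sum_sq (u : Fin d → ℝ) (i : Fin d) : |u i| ≤ Real.sqrt (∑ i, u i ^ 2) :=
  Real.abs_le_sqrt (Finset.single_le_sum (f := fun i => u i ^ 2) (fun _ _ => sq_nonneg _)
    (Finset.mem_univ i))

/-- The lower bound is `exp x ≥ 1 + x`; the upper one is Bernoulli's `v ^ t ≤ 1 + t (v - 1)` with `v
≤ exp R`. Linearity in `t` is what produces `t²` in the descent estimate. -/
lemma abs_rpow_sub_one_le {v R t : ℝ} (hv : 0 < v) (hR : |Real.log v| ≤ R) (ht : 0 ≤ t)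
    (ht1 : t ≤ 1) : |v ^ t - 1| ≤ t * (R + Real.exp R) := by
  have hR' := abs_le.1 hR
  have hR0 : 0 ≤ R := (abs_nonneg _).trans hR
  have hve : v ≤ Real.exp R := by
    rw [← Real.exp_log hv]
    exact Real.exp_le_exp.2 hR'.2
  rw [abs_le]
  constructor
  · have h1 : Real.log v * t + 1 ≤ v ^ t := by
      rw [Real.rpow_def_of_pos hv]
      exact Real.add_one_le_exp _
    have h2 : -(R * t) ≤ Real.log v * t := by nlinarith
    nlinarith [Real.exp_pos R]
  · have h1 := rpow_one_add_le_one_add_mul_self (s := v - 1) (by linarith) ht ht1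
    rw [add_sub_cancel] at h1
    nlinarith

/-- An upper bound for the Euclidean speed of geodesics from points at distance at most `R`
to `B`. -/
noncomputable def speedBound (B : Mat d) (R : ℝ) : ℝ :=
  Real.exp R * B.trace * (d * (R + Real.exp R))

/-- In the basis of `exists_congruence`, `A` becomes the identity and `B` a diagonal matrix with
`|log (v i)| ≤ R`, so both comparisons are read off the diagonal. -/
lemma posSemidef_of_riemDist_le {A B : Mat d} {R : ℝ} (hA : A ∈ PD d) (hB : B ∈ PD d)
    (hR : riemDist A B ≤ R) :
    (A - Real.exp (-R) • B).PosSemidef ∧ (Real.exp R • B - A).PosSemidef := by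
  obtain ⟨W, Wi, v, h1, h2, hv, hWA, hWB, -, hr⟩ := exists_congruence hA hB
  have hlog : ∀ i, |Real.log (v i)| ≤ R := fun i =>
    (abs_le_sqrt_sum_sq (fun i => Real.log (v i)) i).trans (hr ▸ hR)
  have hA' : A = W * Matrix.diagonal (fun _ => (1 : ℝ)) * W.transpose := by
    rw [Matrix.diagonal_one, Matrix.mul_one, hWA]
  have hB' : ∀ c : ℝ, c • B = W * Matrix.diagonal (fun i => c * v i) * W.transpose := by
    intro c
    rw [hWB, ← Matrix.smul_mul, ← Matrix.mul_smul, ← Matrix.diagonal_smul]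
    rfl
  rw [hB', hB', hA', mul_diagonal_mul_transpose_sub, mul_diagonal_mul_transpose_sub,
    posSemidef_mul_diagonal_mul_transpose_iff h1, posSemidef_mul_diagonal_mul_transpose_iff h1]
  refine ⟨fun i => ?_, fun i => ?_⟩
  · rw [sub_nonneg, ← Real.exp_log (hv i), ← Real.exp_add, Real.exp_le_one_iff]
    linarith [(abs_le.1 (hlog i)).2]
  · rw [sub_nonneg, ← Real.exp_log (hv i), ← Real.exp_add, Real.one_le_exp_iff]
    linarith [(abs_le.1 (hlog i)).1]

lemma trace_le_of_riemDist_le {A B : Mat d} {R : ℝ} (hA : A ∈ PD d) (hB : B ∈ PD d)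
    (hR : riemDist A B ≤ R) : A.trace ≤ Real.exp R * B.trace := by
  have := (posSemidef_of_riemDist_le hA hB hR).2.trace_nonneg
  rw [Matrix.trace_sub, Matrix.trace_smul, smul_eq_mul] at this
  linarith

/-- A `riemDist`-bounded set is contained in a box. -/
lemma exists_box_of_riemDist_le {B : Mat d} (hB : B ∈ PD d) (R : ℝ) :
    ∃ a b : ℝ, 0 < a ∧ ∀ A ∈ PD d, riemDist A B ≤ R → A ∈ box d a b := by
  obtain ⟨a, ha, h⟩ := exists_pos_posSemidef_sub (B := B) hB
  refine ⟨Real.exp (-R) * a, Real.exp R * B.trace, by positivity, fun A hA hR => ⟨?_, ?_⟩⟩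
  · have := (posSemidef_of_riemDist_le hA hB hR).1.add (h.smul (Real.exp_pos (-R)).le)
    convert this using 1
    rw [smul_sub, smul_smul]
    abel
  · exact trace_le_of_riemDist_le hA hB hR

/-- The displacement is `W * diagonal (v ^ t - 1) * Wᵀ` with `A = W * Wᵀ`. The outer factors
contribute `‖W‖² = tr A ≤ exp R * tr B`, so the bound depends on `B` and `R` but not on `A`. -/
lemma frobNorm_geodesic_sub_le {A B : Mat d} {R t : ℝ} (hA : A ∈ PD d) (hB : B ∈ PD d)
    (hR : riemDist A B ≤ R) (ht : 0 ≤ t) (ht1 : t ≤ 1) :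
    frobNorm (geodesic A B t - A) ≤ t * speedBound B R := by
  have htr := trace_le_of_riemDist_le hA hB hR
  have hR0 : 0 ≤ R := (frobNorm_nonneg _).trans hR
  obtain ⟨W, Wi, v, h1, h2, hv, hWA, hWB, hg, hr⟩ := exists_congruence hA hB
  have hlog : ∀ i, |Real.log (v i)| ≤ R := fun i =>
    (abs_le_sqrt_sum_sq (fun i => Real.log (v i)) i).trans (hr ▸ hR)
  have hA' : A = W * Matrix.diagonal (fun _ => (1 : ℝ)) * W.transpose := by
    rw [Matrix.diagonal_one, Matrix.mul_one, hWA]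
  have hsub : geodesic A B t - A = W * Matrix.diagonal (fun i => v i ^ t - 1) * W.transpose := by
    rw [hg, ← mul_diagonal_mul_transpose_sub]
    exact congrArg _ hA'
  have hdiag : frobNorm (Matrix.diagonal fun i => v i ^ t - 1) ≤ d * (t * (R + Real.exp R)) :=
    frobNorm_diagonal_le (mul_nonneg ht (by positivity))
      fun i => abs_rpow_sub_one_le (hv i) (hlog i) ht ht1
  rw [hsub]
  calc _ ≤ frobNorm W * frobNorm (Matrix.diagonal fun i => v i ^ t - 1) * frobNorm W.transpose :=
        frobNorm_mul_mul_le _ _ _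
    _ = A.trace * frobNorm (Matrix.diagonal fun i => v i ^ t - 1) := by
        rw [frobNorm_transpose, hWA, ← frobNorm_mul_transpose_self]
        ring
    _ ≤ (Real.exp R * B.trace) * (d * (t * (R + Real.exp R))) :=
        mul_le_mul htr hdiag (frobNorm_nonneg _)
          (mul_nonneg (Real.exp_pos R).le (Matrix.PosDef.posSemidef (M := B) hB).trace_nonneg)
    _ = t * speedBound B R := by rw [speedBound]; ring

lemma speedBound_nonneg {B : Mat d} (hB : B ∈ PD d) {R : ℝ} (hR : 0 ≤ R) :
    0 ≤ speedBound B R := by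
  have : 0 ≤ B.trace := (Matrix.PosDef.posSemidef (M := B) hB).trace_nonneg
  unfold speedBound
  positivity

lemma abs_log_le_two_mul {v ε : ℝ} (h : |v - 1| ≤ ε) (hε : ε ≤ 1 / 2) :
    |Real.log v| ≤ 2 * ε := by
  have h' := abs_le.1 h
  have hv : 1 / 2 ≤ v := by linarith
  rw [abs_le]
  constructor
  · have h1 := Real.one_sub_inv_le_log_of_pos (by linarith : 0 < v)
    have h2 : v⁻¹ ≤ 1 + 2 * ε := by
      rw [inv_le_iff_one_le_mul₀ (by linarith)]
      nlinarith
    linarith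
  · have := Real.log_le_sub_one_of_pos (by linarith : 0 < v)
    linarith

/-- `diagonal (v - 1) = Wi * (B - A) * Wiᵀ` and `‖Wi‖² = tr A⁻¹`, so every `v i` is within `ε ≤ 1/2`
of `1` and `|log (v i)| ≤ 2 ε`. -/
lemma riemDist_le_of_frobNorm_le {A B : Mat d} (hA : A ∈ PD d) (hB : B ∈ PD d)
    (h : A⁻¹.trace * frobNorm (B - A) ≤ 1 / 2) :
    riemDist A B ≤ 2 * d * (A⁻¹.trace * frobNorm (B - A)) := by
  obtain ⟨W, Wi, v, h1, h2, hv, hWA, hWB, -, hr⟩ := exists_congruence hA hB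
  set ε := A⁻¹.trace * frobNorm (B - A) with hε
  have hAinv : A⁻¹ = Wi.transpose * Wi := by rw [hWA, inv_mul_transpose_self h1 h2]
  have hdiag : Matrix.diagonal (fun i => v i - 1) = Wi * (B - A) * Wi.transpose := by
    have hA' : A = W * Matrix.diagonal (fun _ => (1 : ℝ)) * W.transpose := by
      rw [Matrix.diagonal_one, Matrix.mul_one, hWA]
    have : B - A = W * Matrix.diagonal (fun i => v i - 1) * W.transpose := by
      rw [← mul_diagonal_mul_transpose_sub, ← hA', hWB]
    rw [this]
    calc _ = (Wi * W) * Matrix.diagonal (fun i => v i - 1) * (Wi * W).transpose := by simp [h1]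
      _ = _ := by rw [Matrix.transpose_mul]; simp only [Matrix.mul_assoc]
  have hv1 : ∀ i, |v i - 1| ≤ ε := by
    intro i
    have := abs_apply_le_frobNorm (Matrix.diagonal (fun i => v i - 1)) i i
    rw [Matrix.diagonal_apply_eq] at this
    refine this.trans ?_
    rw [hdiag]
    refine (frobNorm_mul_mul_le _ _ _).trans (le_of_eq ?_)
    rw [hε, hAinv, Matrix.trace_mul_comm, ← frobNorm_mul_transpose_self, frobNorm_transpose]
    ring
  have hε0 : 0 ≤ ε := mul_nonneg (Matrix.PosDef.inv (M := A) hA).posSemidef.trace_nonneg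
    (frobNorm_nonneg _)
  rw [hr]
  apply Real.sqrt_le_iff.2
  refine ⟨by positivity, ?_⟩
  calc ∑ i, Real.log (v i) ^ 2 ≤ ∑ _i : Fin d, (2 * ε) ^ 2 := Finset.sum_le_sum fun i _ =>
        sq_le_sq' (abs_le.1 (abs_log_le_two_mul (hv1 i) h)).1
          (abs_le.1 (abs_log_le_two_mul (hv1 i) h)).2
    _ = d * (2 * ε) ^ 2 := by simp
    _ ≤ (d : ℝ) ^ 2 * (2 * ε) ^ 2 := by
      gcongr
      exact_mod_cast Nat.le_self_pow two_ne_zero d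
    _ = (2 * d * ε) ^ 2 := by ring

/-- Positive definite matrices close to `B` are `riemDist`-close to `B`. -/
lemma exists_frobNorm_imp_riemDist_lt {B : Mat d} (hB : B ∈ PD d) {ε : ℝ} (hε : 0 < ε) :
    ∃ r > 0, ∀ A ∈ PD d, frobNorm (A - B) < r → riemDist A B < ε := by
  obtain ⟨r, a, b, hr, ha, hbox⟩ := exists_ball_subset_box hB
  set c : ℝ := d * (d / a) with hc
  have hc0 : 0 ≤ c := by positivity
  -- The first radius keeps `A` in a box where `tr A⁻¹ ≤ c`, the second secures the hypothesis of
  -- `riemDist_le_of_frobNorm_le`, the third its conclusion below `ε`. Adding `1` to `c` and `d`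
  -- keeps the denominators positive.
  refine ⟨min r (min (1 / (2 * (c + 1))) (ε / (2 * (d + 1) * (c + 1)))), by positivity, ?_⟩
  intro A hA hAr
  obtain ⟨h1, h23⟩ := lt_min_iff.1 hAr
  obtain ⟨h2, h3⟩ := lt_min_iff.1 h23
  have hAbox := hbox A (Matrix.PosDef.isHermitian (M := A) hA) h1.le
  have htr : A⁻¹.trace ≤ c := by
    refine (le_abs_self _).trans ((abs_trace_le _).trans ?_)
    rw [hc]
    gcongr
    exact frobNorm_inv_le ha hAbox
  have hn := frobNorm_nonneg (A - B)
  have hε' : A⁻¹.trace * frobNorm (B - A) ≤ c * frobNorm (A - B) := by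
    rw [frobNorm_sub_comm]
    gcongr
  have hle : c * frobNorm (A - B) ≤ 1 / 2 := by
    rw [lt_div_iff₀ (by positivity)] at h2
    nlinarith
  refine (riemDist_le_of_frobNorm_le hA hB (hε'.trans hle)).trans_lt ?_
  rw [lt_div_iff₀ (by positivity)] at h3
  calc 2 * (d : ℝ) * (A⁻¹.trace * frobNorm (B - A)) ≤ 2 * d * (c * frobNorm (A - B)) := by gcongr
    _ ≤ frobNorm (A - B) * (2 * (d + 1) * (c + 1)) := by
      have : (0 : ℝ) ≤ d := Nat.cast_nonneg d
      have h5 : d * c ≤ (d + 1) * (c + 1) := by nlinarith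
      nlinarith
    _ < ε := h3

end Geometry

lemma isSymm_of_mem_PD {X : Mat d} (hX : X ∈ PD d) : X.IsSymm :=
  Matrix.PosDef.isHermitian (M := X) hX

/-! ### Euclidean convexity and gradients on the cone -/

section Convex

lemma mem_nhdsWithin_PD_of_ball {X : Mat d} {r : ℝ} (hr : 0 < r) :
    ∀ᶠ Y in 𝓝[PD d] X, frobNorm (Y - X) < r :=
  nhdsWithin_le_nhds ((tendsto_frobNorm_sub X).eventually_lt_const hr)

/-- The symmetric part of a matrix. -/
noncomputable def symPart (d : ℕ) : Mat d →ₗ[ℝ] Mat d :=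
  (1 / 2 : ℝ) • (LinearMap.id + (Matrix.transposeLinearEquiv (Fin d) (Fin d) ℝ ℝ).toLinearMap)

lemma symPart_apply (A : Mat d) : symPart d A = (1 / 2 : ℝ) • (A + A.transpose) := rfl

lemma symPart_of_isSymm {A : Mat d} (hA : A.IsSymm) : symPart d A = A := by
  rw [symPart_apply, hA.eq, ← two_smul ℝ A, smul_smul]
  norm_num

lemma isSymm_symPart (A : Mat d) : (symPart d A).IsSymm := by
  rw [symPart_apply, Matrix.IsSymm, Matrix.transpose_smul, Matrix.transpose_add,
    Matrix.transpose_transpose, add_comm]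

/-- The cone consists of symmetric matrices, so for `d ≥ 2` it is not open in `Mat d`. Its preimage
under the symmetric part is, and there the continuity of convex functions on open sets applies. -/
lemma isOpen_preimage_symPart : IsOpen (symPart d ⁻¹' PD d) := by
  rw [isOpen_iff_mem_nhds]
  intro A hA
  obtain ⟨r, a, b, hr, ha, hbox⟩ := exists_ball_subset_box (A := symPart d A) hA
  have hc : Continuous fun Y : Mat d => symPart d Y := by
    simp only [symPart_apply]
    fun_prop
  have := ((tendsto_frobNorm_sub (symPart d A)).comp (hc.tendsto A)).eventually_lt_const hr
  filter_upwards [this] with Y hY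
  exact box_subset_PD ha (hbox _ (isSymm_symPart Y) hY.le)

open scoped Matrix.Norms.Frobenius in
lemma continuousOn_of_convexOn {f : Mat d → ℝ} (hf : ConvexOn ℝ (PD d) f) :
    ContinuousOn f (PD d) := by
  have h1 : ConvexOn ℝ (symPart d ⁻¹' PD d) (f ∘ symPart d) := hf.comp_linearMap (symPart d)
  have h2 : ContinuousOn (f ∘ symPart d) (symPart d ⁻¹' PD d) :=
    ConvexOn.continuousOn isOpen_preimage_symPart h1
  refine (h2.mono fun A hA => ?_).congr fun A hA => ?_
  · rw [Set.mem_preimage, symPart_of_isSymm (isSymm_of_mem_PD hA)]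
    exact hA
  · rw [Function.comp_apply, symPart_of_isSymm (isSymm_of_mem_PD hA)]

lemma tendsto_line {X V : Mat d} (hX : X ∈ PD d) (hV : V.IsSymm) :
    Tendsto (fun t : ℝ => X + t • V) (𝓝[>] 0) (𝓝[PD d] X) := by
  have h1 : Tendsto (fun t : ℝ => X + t • V) (𝓝[>] 0) (𝓝 X) := by
    have : Continuous fun t : ℝ => X + t • V := by fun_prop
    simpa using (this.tendsto 0).mono_left nhdsWithin_le_nhds
  refine tendsto_nhdsWithin_iff.2 ⟨h1, ?_⟩
  obtain ⟨r, a, b, hr, ha, hbox⟩ := exists_ball_subset_box hX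
  filter_upwards [((tendsto_frobNorm_sub X).comp h1).eventually_lt_const hr] with t ht
  exact box_subset_PD ha (hbox _ ((isSymm_of_mem_PD hX).add (hV.smul t)) ht.le)

lemma IsEuclGradAt.eventually_line {h : Mat d → ℝ} {G X V : Mat d} (hG : IsEuclGradAt h G X)
    (hX : X ∈ PD d) (hV : V.IsSymm) {ε : ℝ} (hε : 0 < ε) :
    ∀ᶠ t in 𝓝[>] (0 : ℝ), X + t • V ∈ PD d ∧
      |h (X + t • V) - h X - t * frobInner G V| ≤ ε * (t * frobNorm V) := by
  have h1 := (tendsto_line hX hV).eventually (hG.2.def hε)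
  have h2 := (tendsto_line hX hV).eventually eventually_mem_nhdsWithin
  filter_upwards [h1, h2, self_mem_nhdsWithin] with t ht ht2 ht0
  refine ⟨ht2, ?_⟩
  simp only [add_sub_cancel_left, frobInner_smul_right, frobNorm_smul, Real.norm_eq_abs,
    abs_of_pos (Set.mem_Ioi.1 ht0), abs_mul, abs_of_nonneg (frobNorm_nonneg V)] at ht
  exact ht

/-- Convexity on the segment from `X` to `Y` is divided by `t`, the first-order error being at most
`ε t ‖Y - X‖`; then `ε` tends to zero. -/
lemma IsEuclGradAt.add_le {h : Mat d → ℝ} {G X Y : Mat d} (hG : IsEuclGradAt h G X)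
    (hh : ConvexOn ℝ (PD d) h) (hX : X ∈ PD d) (hY : Y ∈ PD d) :
    h X + frobInner G (Y - X) ≤ h Y := by
  have hV : (Y - X).IsSymm := (isSymm_of_mem_PD hY).sub (isSymm_of_mem_PD hX)
  have key : ∀ ε > 0, frobInner G (Y - X) ≤ h Y - h X + ε * frobNorm (Y - X) := by
    intro ε hε
    have hev := hG.eventually_line hX hV hε
    have h1 : ∀ᶠ t in 𝓝[>] (0 : ℝ), t < 1 :=
      nhdsWithin_le_nhds (eventually_lt_nhds one_pos)
    obtain ⟨t, ⟨-, ht⟩, ht1, ht0⟩ := (hev.and (h1.and self_mem_nhdsWithin)).exists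
    have ht0 : 0 < t := ht0
    have hcv := hh.2 hX hY (sub_nonneg.2 ht1.le) ht0.le (sub_add_cancel 1 t)
    have hpt : (1 - t) • X + t • Y = X + t • (Y - X) := by
      rw [sub_smul, one_smul, smul_sub]; abel
    rw [hpt, smul_eq_mul, smul_eq_mul] at hcv
    have h3 := (abs_le.1 ht).1
    have h4 : t * frobInner G (Y - X) ≤ t * (h Y - h X + ε * frobNorm (Y - X)) := by nlinarith
    exact le_of_mul_le_mul_left h4 ht0
  have hlim : Tendsto (fun ε : ℝ => h Y - h X + ε * frobNorm (Y - X)) (𝓝[>] 0)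
      (𝓝 (h Y - h X + 0 * frobNorm (Y - X))) :=
    ((continuous_const.add (continuous_id.mul continuous_const)).tendsto 0).mono_left
      nhdsWithin_le_nhds
  have := ge_of_tendsto hlim (eventually_mem_nhdsWithin.mono fun ε hε => key ε hε)
  linarith

/-- Both expansions are tested in the direction `G - G'`, admissible because gradients are
symmetric. The linear terms differ by `t ‖G - G'‖²`, while two errors with `ε = ‖G - G'‖ / 4`
account for only half of that. -/
lemma IsEuclGradAt.unique {h : Mat d → ℝ} {G G' X : Mat d} (hG : IsEuclGradAt h G X)
    (hG' : IsEuclGradAt h G' X) (hX : X ∈ PD d) : G = G' := by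
  have hV : (G - G').IsSymm := hG.1.sub hG'.1
  have key : frobNorm (G - G') = 0 := by
    by_contra hne
    have hpos : 0 < frobNorm (G - G') := lt_of_le_of_ne (frobNorm_nonneg _) (Ne.symm hne)
    have hε : 0 < frobNorm (G - G') / 4 := by positivity
    obtain ⟨t, ⟨⟨-, h1⟩, ⟨-, h2⟩⟩, ht0⟩ := (((hG.eventually_line hX hV hε).and
      (hG'.eventually_line hX hV hε)).and self_mem_nhdsWithin).exists
    have ht0 : 0 < t := ht0
    have h3 := frobNorm_sq (G - G')
    rw [frobInner_sub_left] at h3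
    have h6 : 0 < t * frobNorm (G - G') ^ 2 := by positivity
    have h7 := abs_le.1 h1
    have h8 := abs_le.1 h2
    have h9 : t * frobNorm (G - G') ^ 2 =
      t * frobInner G (G - G') - t * frobInner G' (G - G') := by rw [h3]; ring
    nlinarith [h7.1, h7.2, h8.1, h8.2]
  exact sub_eq_zero.1 (eq_zero_of_frobNorm_eq_zero key)

lemma SmoothOnPD.isEuclGradAt {h : Mat d → ℝ} (hh : SmoothOnPD h) {X : Mat d} (hX : X ∈ PD d) :
    IsEuclGradAt h (euclGrad h X) X := by
  have H := hh.1 X hX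
  rw [euclGrad, dif_pos H]
  exact H.choose_spec

lemma IsEuclGradAt.euclGrad_eq {h : Mat d → ℝ} {G X : Mat d} (hG : IsEuclGradAt h G X)
    (hX : X ∈ PD d) : euclGrad h X = G := by
  have H : ∃ G, IsEuclGradAt h G X := ⟨G, hG⟩
  rw [euclGrad, dif_pos H]
  exact H.choose_spec.unique hG hX

-- Local Lipschitz continuity is uniform on a compact set. Boxes being convex, the constant also
-- serves the convex hull of any set inside the box.
open scoped Matrix.Norms.Frobenius in
lemma SmoothOnPD.exists_lipschitzGradOn_box {h : Mat d → ℝ} (hh : SmoothOnPD h) {a : ℝ} (ha : 0 < a)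
    (b : ℝ) : ∃ L : ℝ, 0 ≤ L ∧ LipschitzGradOn h L (box d a b) := by
  have hloc : LocallyLipschitzOn (box d a b) (euclGrad h) := by
    intro X hX
    obtain ⟨r, hr, L, hL⟩ := hh.2 X (box_subset_PD ha hX)
    refine ⟨Real.toNNReal L, box d a b ∩ Metric.ball X r, ?_, ?_⟩
    · exact inter_mem_nhdsWithin _ (Metric.ball_mem_nhds X hr)
    · refine LipschitzOnWith.of_dist_le_mul fun Y hY Z hZ => ?_
      have hmem : ∀ Y ∈ box d a b ∩ Metric.ball X r, Y ∈ {Y ∈ PD d | frobNorm (Y - X) < r} := by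
        intro Y hY
        refine ⟨box_subset_PD ha hY.1, ?_⟩
        rw [frobNorm_eq_norm, ← dist_eq_norm]
        exact hY.2
      have := hL Y (hmem Y hY) Z (hmem Z hZ)
      rw [dist_eq_norm, dist_eq_norm, ← frobNorm_eq_norm, ← frobNorm_eq_norm]
      exact this.trans (mul_le_mul_of_nonneg_right (Real.le_coe_toNNReal L) (frobNorm_nonneg _))
  obtain ⟨K, hK⟩ := hloc.exists_lipschitzOnWith_of_compact (isCompact_box ha.le)
  refine ⟨K, K.2, fun X hX Y hY => ?_⟩
  have := hK.dist_le_mul X hX Y hY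
  rwa [dist_eq_norm, dist_eq_norm, ← frobNorm_eq_norm, ← frobNorm_eq_norm] at this

end Convex

/-! ### Gradients from locally Lipschitz subgradients -/

section Subgradient

/-- `g` selects a symmetric subgradient of `h` at each positive definite matrix. -/
structure IsSubgradient (h : Mat d → ℝ) (g : Mat d → Mat d) : Prop where
  isSymm : ∀ X ∈ PD d, (g X).IsSymm
  add_le : ∀ X ∈ PD d, ∀ Y ∈ PD d, h X + frobInner (g X) (Y - X) ≤ h Y

/-- `g` is Lipschitz near each positive definite matrix. -/
def LocLip (g : Mat d → Mat d) : Prop :=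
  ∀ X ∈ PD d, ∃ r > 0, ∃ L : ℝ, ∀ Y ∈ PD d, frobNorm (Y - X) < r →
    ∀ Z ∈ PD d, frobNorm (Z - X) < r → frobNorm (g Y - g Z) ≤ L * frobNorm (Y - Z)

variable {h h' : Mat d → ℝ} {g g' : Mat d → Mat d}

/-- In the weighted average of the subgradient inequalities based at `s • X + t • Y`, the linear
terms cancel. -/
lemma IsSubgradient.convexOn (hg : IsSubgradient h g) : ConvexOn ℝ (PD d) h := by
  refine ⟨convex_PD, fun X hX Y hY s t hs ht hst => ?_⟩
  have hZ : s • X + t • Y ∈ PD d := convex_PD hX hY hs ht hst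
  have h1 := hg.add_le _ hZ X hX
  have h2 := hg.add_le _ hZ Y hY
  set Z := s • X + t • Y with hZdef
  have h3 : s * frobInner (g Z) (X - Z) + t * frobInner (g Z) (Y - Z) = 0 := by
    have e : s • (X - Z) + t • (Y - Z) = 0 := by
      have : s • (X - Z) + t • (Y - Z) = Z - (s + t) • Z := by
        rw [add_smul, smul_sub, smul_sub, hZdef]
        abel
      rw [this, hst, one_smul, sub_self]
    rw [← frobInner_smul_right, ← frobInner_smul_right, ← frobInner_add_right, e,
      frobInner_zero_right]
  rw [smul_eq_mul, smul_eq_mul]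
  have h4 : h Z = s * h Z + t * h Z := by rw [← add_mul, hst, one_mul]
  nlinarith [mul_le_mul_of_nonneg_left h1 hs, mul_le_mul_of_nonneg_left h2 ht]

/-- The subgradient inequalities at `X` and at `Y` trap the first-order remainder between `0` and
`⟨g Y - g X, Y - X⟩`, which is of order `‖Y - X‖²`. No function has to be differentiated directly.
-/
lemma IsSubgradient.isEuclGradAt (hg : IsSubgradient h g) (hl : LocLip g) {X : Mat d}
    (hX : X ∈ PD d) : IsEuclGradAt h (g X) X := by
  refine ⟨hg.isSymm X hX, ?_⟩
  obtain ⟨r, hr, L, hL⟩ := hl X hX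
  rw [Asymptotics.isLittleO_iff]
  intro c hc
  have hr' : 0 < min r (c / (|L| + 1)) := by positivity
  filter_upwards [mem_nhdsWithin_PD_of_ball hr', self_mem_nhdsWithin] with Y hY hYP
  have h0 : frobNorm (X - X) < r := by rw [sub_self, frobNorm_zero]; exact hr
  have h1 := hg.add_le X hX Y hYP
  have h2 := hg.add_le Y hYP X hX
  have h3 : frobInner (g Y) (X - Y) = -frobInner (g Y) (Y - X) := by
    rw [← neg_sub Y X, frobInner_neg_right]
  have h4 := (le_abs_self _).trans (frobInner_le (g Y - g X) (Y - X))
  rw [frobInner_sub_left] at h4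
  have h5 := hL Y hYP (lt_min_iff.1 hY).1 X hX h0
  have hn := frobNorm_nonneg (Y - X)
  have h6 : L * frobNorm (Y - X) ≤ c := by
    have := (lt_min_iff.1 hY).2
    rw [lt_div_iff₀ (by positivity)] at this
    nlinarith [le_abs_self L, abs_nonneg L]
  rw [Real.norm_eq_abs, Real.norm_eq_abs, abs_of_nonneg hn, abs_of_nonneg (by linarith)]
  have h7 : frobNorm (g Y - g X) * frobNorm (Y - X) ≤ c * frobNorm (Y - X) :=
    mul_le_mul_of_nonneg_right (h5.trans h6) hn
  linarith

lemma IsSubgradient.euclGrad_eq (hg : IsSubgradient h g) (hl : LocLip g) {X : Mat d}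
    (hX : X ∈ PD d) : euclGrad h X = g X :=
  (hg.isEuclGradAt hl hX).euclGrad_eq hX

lemma IsSubgradient.smoothOnPD (hg : IsSubgradient h g) (hl : LocLip g) : SmoothOnPD h := by
  refine ⟨fun X hX => ⟨g X, hg.isEuclGradAt hl hX⟩, fun X hX => ?_⟩
  obtain ⟨r, hr, L, hL⟩ := hl X hX
  refine ⟨r, hr, L, fun Y hY Z hZ => ?_⟩
  rw [hg.euclGrad_eq hl hY.1, hg.euclGrad_eq hl hZ.1]
  exact hL Y hY.1 hY.2 Z hZ.1 hZ.2

end Subgradient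

/-! ### Compactness: boundedness, minimizers, minimizing sequences -/

section Bounded

lemma exists_riemDist_le_of_box {B : Mat d} (hB : B ∈ PD d) {a : ℝ} (ha : 0 < a) (b : ℝ) :
    ∃ R : ℝ, ∀ A ∈ box d a b, riemDist A B ≤ R := by
  -- Since `diagonal v = Wi * B * Wiᵀ` and `diagonal v⁻¹ = Wᵀ * B⁻¹ * W`, where `‖Wi‖² = tr A⁻¹` and
  -- `‖W‖² = tr A`, the two summands bound `v i` and `(v i)⁻¹`; their sum then bounds `|log (v i)|`.
  set c : ℝ := d * (d / a) * frobNorm B + |b| * frobNorm B⁻¹ with hc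
  refine ⟨Real.sqrt (∑ _i : Fin d, c ^ 2), fun A hAb => ?_⟩
  have hA := box_subset_PD ha hAb
  obtain ⟨W, Wi, v, h1, h2, hv, hWA, hWB, -, hr⟩ := exists_congruence hA hB
  have hAinv : A⁻¹ = Wi.transpose * Wi := by rw [hWA, inv_mul_transpose_self h1 h2]
  have hd1 : Matrix.diagonal v = Wi * B * Wi.transpose := by
    rw [hWB]
    calc _ = (Wi * W) * Matrix.diagonal v * (Wi * W).transpose := by simp [h1]
      _ = _ := by rw [Matrix.transpose_mul]; simp only [Matrix.mul_assoc]
  have hBinv : B⁻¹ = Wi.transpose * Matrix.diagonal (fun i => (v i)⁻¹) * Wi := by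
    rw [hWB, inv_congruence h1 h2 hv]
  have hd2 : Matrix.diagonal (fun i => (v i)⁻¹) = W.transpose * B⁻¹ * W := by
    rw [hBinv]
    calc _ = (Wi * W).transpose * Matrix.diagonal (fun i => (v i)⁻¹) * (Wi * W) := by simp [h1]
      _ = _ := by rw [Matrix.transpose_mul]; simp only [Matrix.mul_assoc]
  have hB0 := frobNorm_nonneg B
  have hB1 := frobNorm_nonneg B⁻¹
  have hup : ∀ i, v i ≤ d * (d / a) * frobNorm B := by
    intro i
    have h := (le_abs_self _).trans (abs_apply_le_frobNorm (Matrix.diagonal v) i i)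
    rw [Matrix.diagonal_apply_eq, hd1] at h
    have h3 : frobNorm Wi ^ 2 ≤ d * (d / a) := by
      rw [frobNorm_mul_transpose_self, Matrix.trace_mul_comm, ← hAinv]
      refine (le_abs_self _).trans ((abs_trace_le _).trans ?_)
      gcongr
      exact frobNorm_inv_le ha hAb
    calc v i ≤ _ := h
      _ ≤ frobNorm Wi * frobNorm B * frobNorm Wi.transpose := frobNorm_mul_mul_le _ _ _
      _ = frobNorm Wi ^ 2 * frobNorm B := by rw [frobNorm_transpose]; ring
      _ ≤ _ := by gcongr
  have hlo : ∀ i, (v i)⁻¹ ≤ |b| * frobNorm B⁻¹ := by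
    intro i
    have h := (le_abs_self _).trans
      (abs_apply_le_frobNorm (Matrix.diagonal (fun i => (v i)⁻¹)) i i)
    rw [Matrix.diagonal_apply_eq, hd2] at h
    have h3 : frobNorm W ^ 2 ≤ |b| := by
      rw [frobNorm_mul_transpose_self, ← hWA]
      exact hAb.2.trans (le_abs_self b)
    calc (v i)⁻¹ ≤ _ := h
      _ ≤ frobNorm W.transpose * frobNorm B⁻¹ * frobNorm W := frobNorm_mul_mul_le _ _ _
      _ = frobNorm W ^ 2 * frobNorm B⁻¹ := by rw [frobNorm_transpose]; ring
      _ ≤ _ := by gcongr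
  rw [hr]
  apply Real.sqrt_le_sqrt
  refine Finset.sum_le_sum fun i _ => sq_le_sq' ?_ ?_
  · have h3 := Real.one_sub_inv_le_log_of_pos (hv i)
    have h4 : 0 ≤ d * (d / a) * frobNorm B := by positivity
    linarith [hlo i]
  · have h3 := Real.log_le_sub_one_of_pos (hv i)
    have h4 : 0 ≤ |b| * frobNorm B⁻¹ := by positivity
    linarith [hup i]

lemma exists_isMinimizer {φ : Mat d → ℝ} (hc : ContinuousOn φ (PD d)) {K : Set (Mat d)}
    (hK : IsCompact K) (hKP : K ⊆ PD d) {X : Mat d} (hX : X ∈ K)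
    (hsub : ∀ Y ∈ PD d, φ Y ≤ φ X → Y ∈ K) : ∃ Y, IsMinimizer φ Y := by
  obtain ⟨Z, hZ, hmin⟩ := hK.exists_isMinOn ⟨X, hX⟩ (hc.mono hKP)
  refine ⟨Z, hKP hZ, fun Y hY => ?_⟩
  rcases le_total (φ Y) (φ X) with h | h
  · exact hmin (hsub Y hY h)
  · exact (hmin hX).trans h

/-- A minimizing sequence in a compact set eventually enters every neighborhood of the set of
minimizers. -/
lemma eventually_mem_of_isOpen {φ : Mat d → ℝ} (hc : ContinuousOn φ (PD d)) {K U : Set (Mat d)}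
    (hK : IsCompact K) (hKP : K ⊆ PD d) (hU : IsOpen U) (hmin : ∀ Y, IsMinimizer φ Y → Y ∈ U)
    {Xs : Mat d} (hXs : IsMinimizer φ Xs) {X : ℕ → Mat d} (hX : ∀ k, X k ∈ K)
    (hlim : Tendsto (fun k => φ (X k)) atTop (𝓝 (φ Xs))) : ∀ᶠ k in atTop, X k ∈ U := by
  rcases (K \ U).eq_empty_or_nonempty with hE | hne
  · refine Eventually.of_forall fun k => ?_
    by_contra hk
    have : X k ∈ K \ U := ⟨hX k, hk⟩
    rw [hE] at this
    exact this
  -- The minimum of `φ` over the compact set `K \ U` exceeds `φ Xs` strictly, since otherwise the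
  -- point attaining it would be a minimizer outside `U`.
  · obtain ⟨Z, hZ, hZmin⟩ := (hK.diff hU).exists_isMinOn hne
      (hc.mono (Set.sdiff_subset.trans hKP))
    have hlt : φ Xs < φ Z := by
      by_contra hle
      exact hZ.2 (hmin Z ⟨hKP hZ.1, fun Y hY => (not_lt.1 hle).trans (hXs.2 Y hY)⟩)
    filter_upwards [hlim.eventually_lt_const hlt] with k hk
    by_contra hkU
    exact absurd (hZmin ⟨hX k, hkU⟩ : φ Z ≤ φ (X k)) (not_le.2 hk)

lemma isOpen_frobNorm_ball (Y : Mat d) (r : ℝ) : IsOpen {A : Mat d | frobNorm (A - Y) < r} :=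
  isOpen_lt (continuous_frobNorm.comp (continuous_id.sub continuous_const)) continuous_const

lemma eventually_riemDist_lt {φ : Mat d → ℝ} (hc : ContinuousOn φ (PD d)) {K : Set (Mat d)}
    (hK : IsCompact K) (hKP : K ⊆ PD d) {Xs : Mat d} (hXs : IsMinimizer φ Xs) {X : ℕ → Mat d}
    (hX : ∀ k, X k ∈ K) (hlim : Tendsto (fun k => φ (X k)) atTop (𝓝 (φ Xs))) {ε : ℝ}
    (hε : 0 < ε) : ∀ᶠ k in atTop, ∃ Y, IsMinimizer φ Y ∧ riemDist (X k) Y < ε := by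
  have hr : ∀ Y : {Y // IsMinimizer φ Y}, ∃ r > 0, ∀ A ∈ PD d, frobNorm (A - Y.1) < r →
      riemDist A Y.1 < ε := fun Y => exists_frobNorm_imp_riemDist_lt Y.2.1 hε
  choose r hr0 hr using hr
  -- The neighborhood is a union of balls, one around each minimizer with its own radius, so no
  -- uniform radius is needed.
  have hev := eventually_mem_of_isOpen hc hK hKP
    (U := ⋃ Y : {Y // IsMinimizer φ Y}, {A : Mat d | frobNorm (A - Y.1) < r Y})
    (isOpen_iUnion fun Y => isOpen_frobNorm_ball _ _)
    (fun Y hY => Set.mem_iUnion.2 ⟨⟨Y, hY⟩, by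
      change frobNorm (Y - Y) < _
      rw [sub_self, frobNorm_zero]
      exact hr0 _⟩) hXs hX hlim
  filter_upwards [hev] with k hk
  obtain ⟨Y, hY⟩ := Set.mem_iUnion.1 hk
  exact ⟨Y.1, Y.2, hr Y _ (hKP (hX k)) hY⟩

lemma tendsto_of_unique_minimizer {φ : Mat d → ℝ} (hc : ContinuousOn φ (PD d)) {K : Set (Mat d)}
    (hK : IsCompact K) (hKP : K ⊆ PD d) {Xs : Mat d} (hXs : IsMinimizer φ Xs)
    (huniq : ∀ Y, IsMinimizer φ Y → Y = Xs) {X : ℕ → Mat d}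
    (hX : ∀ k, X k ∈ K) (hlim : Tendsto (fun k => φ (X k)) atTop (𝓝 (φ Xs))) :
    Tendsto X atTop (𝓝 Xs) := by
  refine tendsto_nhds.2 fun U hU hXsU => ?_
  exact eventually_mem_of_isOpen hc hK hKP hU (fun Y hY => huniq Y hY ▸ hXsU) hXs hX hlim

end Bounded

/-! ### The scalar recursion -/

section Rate

/-- The induction takes `t = 2 / (k + 2)` and closes by `(k + 1) / (k + 2)² ≤ 1 / (k + 3)`. In the
base case `t = 1` eliminates `Δ 0`, which is why no bound on the initial gap is needed and the rate
starts at `k = 1`. -/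
lemma le_div_of_forall_le {Δ : ℕ → ℝ} {C : ℝ} (hC : 0 ≤ C)
    (hΔ : ∀ k, ∀ t : ℝ, 0 ≤ t → t ≤ 1 → Δ (k + 1) ≤ (1 - t) * Δ k + C * t ^ 2) :
    ∀ k : ℕ, 1 ≤ k → Δ k ≤ 4 * C / (k + 2) := by
  intro k hk
  induction k, hk using Nat.le_induction with
  | base =>
    have := hΔ 0 1 zero_le_one le_rfl
    norm_num at this ⊢
    linarith
  | succ k hk ih =>
    have hk2 : (0 : ℝ) < k + 2 := by positivity
    have h2 : (2 : ℝ) / (k + 2) ≤ 1 := by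
      rw [div_le_one hk2]
      linarith [(Nat.cast_nonneg k : (0 : ℝ) ≤ k)]
    have h := hΔ k (2 / (k + 2)) (by positivity) h2
    have h3 : (1 - 2 / ((k : ℝ) + 2)) * Δ k ≤ (1 - 2 / ((k : ℝ) + 2)) * (4 * C / (k + 2)) :=
      mul_le_mul_of_nonneg_left ih (by linarith)
    have h4 : (1 - 2 / ((k : ℝ) + 2)) * (4 * C / (k + 2)) + C * (2 / (k + 2)) ^ 2 =
        4 * C * ((k + 1) / (k + 2) ^ 2) := by
      field_simp
      ring
    have h5 : ((k : ℝ) + 1) / (k + 2) ^ 2 ≤ 1 / (k + 3) := by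
      rw [div_le_div_iff₀ (by positivity) (by positivity)]
      nlinarith
    calc Δ (k + 1) ≤ 4 * C * ((k + 1) / (k + 2) ^ 2) := by linarith
      _ ≤ 4 * C * (1 / (k + 3)) := by gcongr
      _ = 4 * C / (↑(k + 1) + 2) := by push_cast; ring

end Rate

/-! ### The convex-concave procedure -/

section CCCP

variable {φ f h : Mat d → ℝ} {X₀ : Mat d}

lemma IsDC.continuousOn (hdc : IsDC φ f h) : ContinuousOn φ (PD d) :=
  ((continuousOn_of_convexOn hdc.convex_f).sub (continuousOn_of_convexOn hdc.convex_h)).congr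
    fun X hX => hdc.eq_sub X hX

lemma isCompact_sublevel (hc : ContinuousOn φ (PD d)) {a b : ℝ} (ha : 0 < a)
    (hsub : sublevel φ X₀ ⊆ box d a b) : IsCompact (sublevel φ X₀) := by
  have hbox := box_subset_PD (d := d) (b := b) ha
  have h1 : IsClosed (box d a b ∩ φ ⁻¹' Set.Iic (φ X₀)) :=
    (hc.mono hbox).preimage_isClosed_of_isClosed (isCompact_box ha.le).isClosed isClosed_Iic
  have h2 : sublevel φ X₀ = box d a b ∩ φ ⁻¹' Set.Iic (φ X₀) :=
    Set.Subset.antisymm (fun X hX => ⟨hsub hX, hX.2⟩) fun X hX => ⟨hbox hX.1, hX.2⟩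
  rw [h2]
  exact (isCompact_box ha.le).of_isClosed_subset h1 Set.inter_subset_left

lemma IsDC.le_surrogate (hdc : IsDC φ f h) {X Y : Mat d} (hX : X ∈ PD d) (hY : Y ∈ PD d) :
    φ X ≤ surrogate f h X Y := by
  have := (hdc.smooth_h.isEuclGradAt hY).add_le hdc.convex_h hY hX
  rw [hdc.eq_sub X hX, surrogate]
  linarith

lemma IsDC.surrogate_self (hdc : IsDC φ f h) {X : Mat d} (hX : X ∈ PD d) :
    surrogate f h X X = φ X := by
  rw [hdc.eq_sub X hX, surrogate, sub_self, frobInner_zero_right, sub_zero]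

/-- The excess of the surrogate is the Bregman remainder of `h`, controlled by the gradient
inequality of `h` at `X`. Only the gradients at `X` and `Y` enter, so no segment between them is
integrated over. -/
lemma IsDC.surrogate_le (hdc : IsDC φ f h) {X Y : Mat d} (hX : X ∈ PD d) (hY : Y ∈ PD d) :
    surrogate f h X Y ≤ φ X + frobNorm (euclGrad h X - euclGrad h Y) * frobNorm (X - Y) := by
  have h1 := (hdc.smooth_h.isEuclGradAt hX).add_le hdc.convex_h hX hY
  have h2 := (le_abs_self _).trans (frobInner_le (euclGrad h X - euclGrad h Y) (X - Y))
  rw [frobInner_sub_left] at h2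
  rw [← neg_sub X Y, frobInner_neg_right] at h1
  rw [hdc.eq_sub X hX, surrogate]
  linarith

lemma IsDC.continuousOn_surrogate (hdc : IsDC φ f h) (Y : Mat d) :
    ContinuousOn (fun X => surrogate f h X Y) (PD d) := by
  have hf := continuousOn_of_convexOn hdc.convex_f
  have h1 : Continuous fun X : Mat d => frobInner (euclGrad h Y) (X - Y) :=
    (continuous_frobInner_right _).comp (continuous_id.sub continuous_const)
  exact (hf.sub continuousOn_const).sub h1.continuousOn

lemma IsDC.le_of_surrogate_le (hdc : IsDC φ f h) {X Y : Mat d} (hX : X ∈ PD d) (hY : Y ∈ PD d)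
    (hle : surrogate f h X Y ≤ surrogate f h Y Y) : φ X ≤ φ Y :=
  (hdc.le_surrogate hX hY).trans (hle.trans (hdc.surrogate_self hY).le)

lemma IsCCCP.mem_sublevel {X : ℕ → Mat d} (hX : IsCCCP f h X₀ X) (hdc : IsDC φ f h)
    (hX₀ : X₀ ∈ PD d) (k : ℕ) : X k ∈ sublevel φ X₀ := by
  induction k with
  | zero => rw [hX.1]; exact ⟨hX₀, le_rfl⟩
  | succ k ih =>
    exact ⟨(hX.2 k).1,
      (hdc.le_of_surrogate_le (hX.2 k).1 ih.1 ((hX.2 k).2 _ ih.1)).trans ih.2⟩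

lemma IsDC.exists_isCCCP (hdc : IsDC φ f h) (hX₀ : X₀ ∈ PD d)
    (hS : IsCompact (sublevel φ X₀)) : ∃ X, IsCCCP f h X₀ X := by
  -- Points where the surrogate does not exceed its value at `Y` stay in the compact sublevel set,
  -- so a minimizer exists there; working in the subtype lets the choice be iterated.
  have hstep : ∀ Y : sublevel φ X₀, ∃ Z : sublevel φ X₀,
      IsMinimizer (fun X => surrogate f h X Y.1) Z.1 := by
    intro Y
    have hY := Y.2
    obtain ⟨Z, hZ⟩ := exists_isMinimizer (hdc.continuousOn_surrogate Y.1) hS (fun X hX => hX.1) hY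
      fun X hX hle => ⟨hX, (hdc.le_of_surrogate_le hX hY.1 hle).trans hY.2⟩
    exact ⟨⟨Z, hZ.1, (hdc.le_of_surrogate_le hZ.1 hY.1 (hZ.2 _ hY.1)).trans hY.2⟩, hZ⟩
  choose next hnext using hstep
  have hmem : X₀ ∈ sublevel φ X₀ := ⟨hX₀, le_rfl⟩
  refine ⟨fun k => (next^[k] ⟨X₀, hmem⟩).1, rfl, fun k => ?_⟩
  simp only [Function.iterate_succ_apply']
  exact hnext _

/-- One step of the procedure, compared with a point on the geodesic to a minimizer. -/
lemma IsCCCP.descent {X : ℕ → Mat d} (hX : IsCCCP f h X₀ X) (hg : GConvex φ) (hdc : IsDC φ f h)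
    (hX₀ : X₀ ∈ PD d) {Xs : Mat d} {R L : ℝ} (hXs : IsMinimizer φ Xs)
    (hR : ∀ Y ∈ sublevel φ X₀, riemDist Y Xs ≤ R) (hL0 : 0 ≤ L)
    (hL : LipschitzGradOn h L (convexHull ℝ (sublevel φ X₀))) (k : ℕ) {t : ℝ} (ht : 0 ≤ t)
    (ht1 : t ≤ 1) :
    φ (X (k + 1)) - φ Xs ≤ (1 - t) * (φ (X k) - φ Xs) + L * speedBound Xs R ^ 2 * t ^ 2 := by
  have hk := hX.mem_sublevel hdc hX₀ k
  set Z := geodesic (X k) Xs t with hZ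
  have hZP : Z ∈ PD d := geodesic_mem hk.1 hXs.1 t
  have hconv : φ Z ≤ (1 - t) * φ (X k) + t * φ Xs := by
    have := (hg (X k) hk.1 Xs hXs.1).2 (Set.left_mem_Icc.2 zero_le_one)
      (Set.right_mem_Icc.2 zero_le_one) (sub_nonneg.2 ht1) ht (sub_add_cancel 1 t)
    simpa [geodesic_zero hk.1 hXs.1, geodesic_one hk.1 hXs.1, ← hZ] using this
  -- The geodesic towards a minimizer never leaves the sublevel set, so the Lipschitz constant `L`
  -- applies to `Z`.
  have hZle : φ Z ≤ φ (X k) := by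
    have := hXs.2 _ hk.1
    nlinarith
  have hZS : Z ∈ sublevel φ X₀ := ⟨hZP, hZle.trans hk.2⟩
  have hlip := hL Z (subset_convexHull ℝ _ hZS) (X k) (subset_convexHull ℝ _ hk)
  have hspeed := frobNorm_geodesic_sub_le hk.1 hXs.1 (hR _ hk) ht ht1
  rw [← hZ] at hspeed
  have h1 := hdc.le_surrogate (hX.2 k).1 hk.1
  have h2 : surrogate f h (X (k + 1)) (X k) ≤ surrogate f h Z (X k) := (hX.2 k).2 Z hZP
  have h3 := hdc.surrogate_le hZP hk.1
  have hn := frobNorm_nonneg (Z - X k)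
  have h4 : frobNorm (euclGrad h Z - euclGrad h (X k)) * frobNorm (Z - X k) ≤
      L * speedBound Xs R ^ 2 * t ^ 2 := by
    calc _ ≤ L * frobNorm (Z - X k) * frobNorm (Z - X k) := by gcongr
      _ = L * frobNorm (Z - X k) ^ 2 := by ring
      _ ≤ L * (t * speedBound Xs R) ^ 2 := by gcongr
      _ = _ := by ring
  linarith

/-- The recursion gives the constant `4 L s²` with `s` the speed bound; in the form `2 L α²` this
forces `α = √2 s`. -/
lemma IsCCCP.sub_le_div {X : ℕ → Mat d} (hX : IsCCCP f h X₀ X) (hg : GConvex φ) (hdc : IsDC φ f h)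
    (hX₀ : X₀ ∈ PD d) {Xs : Mat d} {R L : ℝ} (hXs : IsMinimizer φ Xs)
    (hR : ∀ Y ∈ sublevel φ X₀, riemDist Y Xs ≤ R) (hL0 : 0 ≤ L)
    (hL : LipschitzGradOn h L (convexHull ℝ (sublevel φ X₀))) (k : ℕ) (hk : 1 ≤ k) :
    φ (X k) - φ Xs ≤ 2 * L * (Real.sqrt 2 * speedBound Xs R) ^ 2 / (k + 2) := by
  have := le_div_of_forall_le (Δ := fun k => φ (X k) - φ Xs)
    (mul_nonneg hL0 (sq_nonneg (speedBound Xs R)))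
    (fun k t ht ht1 => hX.descent hg hdc hX₀ hXs hR hL0 hL k ht ht1) k hk
  refine this.trans (le_of_eq ?_)
  rw [mul_pow, Real.sq_sqrt zero_le_two]
  ring

lemma IsDC.exists_lipschitzGradOn (hdc : IsDC φ f h) {a b : ℝ} (ha : 0 < a)
    (hsub : sublevel φ X₀ ⊆ box d a b) :
    ∃ L : ℝ, 0 ≤ L ∧ LipschitzGradOn h L (convexHull ℝ (sublevel φ X₀)) := by
  obtain ⟨L, hL0, hL⟩ := hdc.smooth_h.exists_lipschitzGradOn_box ha b
  have hh := convexHull_min hsub (convex_box a b)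
  exact ⟨L, hL0, fun X hX Y hY => hL X (hh hX) Y (hh hY)⟩

lemma IsCCCP.tendsto {X : ℕ → Mat d} (hX : IsCCCP f h X₀ X) (hg : GConvex φ) (hdc : IsDC φ f h)
    (hX₀ : X₀ ∈ PD d) {Xs : Mat d} (hXs : IsMinimizer φ Xs) {a b : ℝ} (ha : 0 < a)
    (hsub : sublevel φ X₀ ⊆ box d a b) : Tendsto (fun k => φ (X k)) atTop (𝓝 (φ Xs)) := by
  obtain ⟨L, hL0, hL⟩ := hdc.exists_lipschitzGradOn ha hsub
  obtain ⟨R, hR⟩ := exists_riemDist_le_of_box hXs.1 ha b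
  set C := 2 * L * (Real.sqrt 2 * speedBound Xs R) ^ 2 with hC
  have hrate : ∀ k : ℕ, 1 ≤ k → φ (X k) ≤ φ Xs + C / (k + 2) := fun k hk => by
    have := hX.sub_le_div hg hdc hX₀ hXs (fun Y hY => hR Y (hsub hY)) hL0 hL k hk
    linarith
  have hlim : Tendsto (fun k : ℕ => φ Xs + C / ((k : ℝ) + 2)) atTop (𝓝 (φ Xs)) := by
    have h1 : Tendsto (fun k : ℕ => (k : ℝ) + 2) atTop atTop :=
      tendsto_atTop_add_const_right _ _ tendsto_natCast_atTop_atTop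
    simpa using (tendsto_const_nhds (x := φ Xs)).add ((tendsto_const_nhds (x := C)).div_atTop h1)
  refine tendsto_of_tendsto_of_tendsto_of_le_of_le' tendsto_const_nhds hlim
    (Eventually.of_forall fun k => hXs.2 _ (hX.mem_sublevel hdc hX₀ k).1) ?_
  filter_upwards [eventually_ge_atTop 1] with k hk using hrate k hk

theorem cccp_convergence (hg : GConvex φ) (hdc : IsDC φ f h) (hX₀ : X₀ ∈ PD d)
    (hB : ∃ B : ℝ, ∀ Y ∈ sublevel φ X₀, riemDist Y X₀ ≤ B) :
    (∃ Xs, IsMinimizer φ Xs) ∧ (∃ X, IsCCCP f h X₀ X) ∧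
      (∃ L : ℝ, 0 ≤ L ∧ LipschitzGradOn h L (convexHull ℝ (sublevel φ X₀))) ∧
      ∀ X : ℕ → Mat d, IsCCCP f h X₀ X →
        (∀ (Xs : Mat d) (R L : ℝ), IsMinimizer φ Xs →
          (∀ Y ∈ sublevel φ X₀, riemDist Y Xs ≤ R) → 0 ≤ L →
          LipschitzGradOn h L (convexHull ℝ (sublevel φ X₀)) →
          ∀ k : ℕ, 1 ≤ k →
            φ (X k) - φ Xs ≤ 2 * L * (Real.sqrt 2 * speedBound Xs R) ^ 2 / (k + 2)) ∧
        (∀ ε : ℝ, 0 < ε → ∀ᶠ k in atTop, ∃ Y, IsMinimizer φ Y ∧ riemDist (X k) Y < ε) := by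
  obtain ⟨B, hB⟩ := hB
  obtain ⟨a, b, ha, hbox⟩ := exists_box_of_riemDist_le hX₀ B
  have hsub : sublevel φ X₀ ⊆ box d a b := fun Y hY => hbox Y hY.1 (hB Y hY)
  have hS := isCompact_sublevel hdc.continuousOn ha hsub
  obtain ⟨Xs, hXs⟩ := exists_isMinimizer hdc.continuousOn hS (fun X hX => hX.1)
    (⟨hX₀, le_rfl⟩ : X₀ ∈ sublevel φ X₀) fun Y hY hle => ⟨hY, hle⟩
  refine ⟨⟨Xs, hXs⟩, hdc.exists_isCCCP hX₀ hS, hdc.exists_lipschitzGradOn ha hsub,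
    fun X hX => ⟨fun Xs R L hXs hR hL0 hL k hk => hX.sub_le_div hg hdc hX₀ hXs hR hL0 hL k hk,
      fun ε hε => ?_⟩⟩
  exact eventually_riemDist_lt hdc.continuousOn hS (fun X hX => hX.1) hXs
    (hX.mem_sublevel hdc hX₀) (hX.tendsto hg hdc hX₀ hXs ha hsub) hε

end CCCP

/-! ### Subgradients of `-log det` and `tr (S X⁻¹)`, and their Lipschitz bounds -/

section Calculus

/-- `g` is Lipschitz on every box of positive definite matrices. -/
def LipOnBoxes (g : Mat d → Mat d) : Prop :=
  ∀ a b : ℝ, 0 < a → ∃ L : ℝ, 0 ≤ L ∧ ∀ X ∈ box d a b, ∀ Y ∈ box d a b,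
    frobNorm (g X - g Y) ≤ L * frobNorm (X - Y)

variable {h h' : Mat d → ℝ} {g g' : Mat d → Mat d}

lemma LipOnBoxes.locLip (hg : LipOnBoxes g) : LocLip g := by
  intro X hX
  obtain ⟨r, a, b, hr, ha, hbox⟩ := exists_ball_subset_box hX
  obtain ⟨L, -, hL⟩ := hg a b ha
  exact ⟨r, hr, L, fun Y hY hYr Z hZ hZr => hL Y (hbox Y (isSymm_of_mem_PD hY) hYr.le) Z
    (hbox Z (isSymm_of_mem_PD hZ) hZr.le)⟩

lemma LipOnBoxes.add (hg : LipOnBoxes g) (hg' : LipOnBoxes g') :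
    LipOnBoxes fun X => g X + g' X := by
  intro a b ha
  obtain ⟨L, hL0, hL⟩ := hg a b ha
  obtain ⟨L', hL0', hL'⟩ := hg' a b ha
  refine ⟨L + L', by positivity, fun X hX Y hY => ?_⟩
  rw [add_sub_add_comm, add_mul]
  exact (frobNorm_add_le _ _).trans (add_le_add (hL X hX Y hY) (hL' X hX Y hY))

lemma LipOnBoxes.smul (hg : LipOnBoxes g) (c : ℝ) : LipOnBoxes fun X => c • g X := by
  intro a b ha
  obtain ⟨L, hL0, hL⟩ := hg a b ha
  refine ⟨|c| * L, by positivity, fun X hX Y hY => ?_⟩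
  rw [← smul_sub, frobNorm_smul, mul_assoc]
  exact mul_le_mul_of_nonneg_left (hL X hX Y hY) (abs_nonneg c)

lemma IsSubgradient.add (hg : IsSubgradient h g) (hg' : IsSubgradient h' g') :
    IsSubgradient (fun X => h X + h' X) fun X => g X + g' X := by
  refine ⟨fun X hX => (hg.isSymm X hX).add (hg'.isSymm X hX), fun X hX Y hY => ?_⟩
  rw [frobInner_add_left]
  linarith [hg.add_le X hX Y hY, hg'.add_le X hX Y hY]

lemma IsSubgradient.smul (hg : IsSubgradient h g) {c : ℝ} (hc : 0 ≤ c) :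
    IsSubgradient (fun X => c * h X) fun X => c • g X := by
  refine ⟨fun X hX => (hg.isSymm X hX).smul c, fun X hX Y hY => ?_⟩
  rw [frobInner_smul_left, ← mul_add]
  exact mul_le_mul_of_nonneg_left (hg.add_le X hX Y hY) hc

lemma IsSubgradient.congr_add_const (hg : IsSubgradient h g) (c : ℝ)
    (hh : ∀ X ∈ PD d, h' X = h X + c) (hgg : ∀ X, g' X = g X) : IsSubgradient h' g' := by
  refine ⟨fun X hX => hgg X ▸ hg.isSymm X hX, fun X hX Y hY => ?_⟩
  rw [hh X hX, hh Y hY, hgg X]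
  linarith [hg.add_le X hX Y hY]

/-- After diagonalizing `B`, the trace is a sum of diagonal entries of `Uᵀ A U` weighted by
eigenvalues of `B`, all nonnegative. -/
lemma trace_mul_nonneg {A B : Mat d} (hA : A.PosSemidef) (hB : B.PosSemidef) :
    0 ≤ (A * B).trace := by
  obtain ⟨U, v, h1, h2, h3, -⟩ := exists_diagonalization hB.1
  have hv := (posSemidef_mul_diagonal_mul_transpose_iff h1).1 (h3 ▸ hB)
  have h4 : (U.transpose * A * U).PosSemidef := hA.conjTranspose_mul_mul_same U
  have h5 : (A * B).trace = (U.transpose * A * U * Matrix.diagonal v).trace := by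
    rw [h3, ← Matrix.mul_assoc, Matrix.trace_mul_comm]
    simp only [Matrix.mul_assoc]
  rw [h5, Matrix.trace]
  refine Finset.sum_nonneg fun i _ => ?_
  rw [Matrix.diag_apply, Matrix.mul_diagonal]
  exact mul_nonneg h4.diag_nonneg (hv i)

lemma isSymm_inv {X : Mat d} (hX : X ∈ PD d) : (X⁻¹).IsSymm :=
  (Matrix.PosDef.inv (M := X) hX).1

lemma inv_mul_cancel_of_mem {X : Mat d} (hX : X ∈ PD d) : X⁻¹ * X = 1 :=
  Matrix.nonsing_inv_mul X (Matrix.PosDef.det_pos (A := X) hX).ne'.isUnit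

lemma mul_inv_cancel_of_mem {X : Mat d} (hX : X ∈ PD d) : X * X⁻¹ = 1 :=
  Matrix.mul_nonsing_inv X (Matrix.PosDef.det_pos (A := X) hX).ne'.isUnit

lemma inv_sub_inv_of_mem {X Y : Mat d} (hX : X ∈ PD d) (hY : Y ∈ PD d) :
    X⁻¹ - Y⁻¹ = X⁻¹ * (Y - X) * Y⁻¹ := by
  rw [Matrix.mul_sub, Matrix.sub_mul, inv_mul_cancel_of_mem hX, Matrix.mul_assoc,
    mul_inv_cancel_of_mem hY, Matrix.mul_one, Matrix.one_mul]

lemma lipOnBoxes_inv : LipOnBoxes fun X : Mat d => X⁻¹ := by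
  intro a b ha
  refine ⟨(d / a) * (d / a), by positivity, fun X hX Y hY => ?_⟩
  rw [inv_sub_inv_of_mem (box_subset_PD ha hX) (box_subset_PD ha hY)]
  have h1 := frobNorm_inv_le ha hX
  have h2 := frobNorm_inv_le ha hY
  calc _ ≤ frobNorm X⁻¹ * frobNorm (Y - X) * frobNorm Y⁻¹ := frobNorm_mul_mul_le _ _ _
    _ ≤ (d / a) * frobNorm (Y - X) * (d / a) := by
      have := frobNorm_nonneg (Y - X)
      have := frobNorm_nonneg X⁻¹
      have := frobNorm_nonneg Y⁻¹
      gcongr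
    _ = _ := by rw [frobNorm_sub_comm]; ring

lemma add_mem_box_of_posSemidef {a b : ℝ} {X T : Mat d} (hX : X ∈ box d a b)
    (hT : T.PosSemidef) : X + T ∈ box d a (b + T.trace) := by
  refine ⟨?_, ?_⟩
  · have := hX.1.add hT
    convert this using 1
    abel
  · rw [Matrix.trace_add]
    linarith [hX.2]

lemma lipOnBoxes_inv_add {T : Mat d} (hT : T.PosSemidef) :
    LipOnBoxes fun X : Mat d => (X + T)⁻¹ := by
  intro a b ha
  obtain ⟨L, hL0, hL⟩ := lipOnBoxes_inv (d := d) a (b + T.trace) ha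
  refine ⟨L, hL0, fun X hX Y hY => ?_⟩
  have := hL _ (add_mem_box_of_posSemidef hX hT) _ (add_mem_box_of_posSemidef hY hT)
  rwa [add_sub_add_right_eq_sub] at this

lemma lipOnBoxes_inv_mul_mul_inv (S : Mat d) : LipOnBoxes fun X : Mat d => X⁻¹ * S * X⁻¹ := by
  intro a b ha
  obtain ⟨L, hL0, hL⟩ := lipOnBoxes_inv (d := d) a b ha
  have hS := frobNorm_nonneg S
  refine ⟨2 * L * frobNorm S * (d / a), by positivity, fun X hX Y hY => ?_⟩
  have h1 := frobNorm_inv_le ha hX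
  have h2 := frobNorm_inv_le ha hY
  have h3 := hL X hX Y hY
  have h4 := frobNorm_nonneg (X - Y)
  have h5 := frobNorm_nonneg (X⁻¹ - Y⁻¹)
  have h6 := frobNorm_nonneg X⁻¹
  have h7 := frobNorm_nonneg Y⁻¹
  have e : X⁻¹ * S * X⁻¹ - Y⁻¹ * S * Y⁻¹ =
      (X⁻¹ - Y⁻¹) * S * X⁻¹ + Y⁻¹ * S * (X⁻¹ - Y⁻¹) := by
    simp only [Matrix.sub_mul, Matrix.mul_sub]
    abel
  rw [e]
  calc _ ≤ frobNorm (X⁻¹ - Y⁻¹) * frobNorm S * frobNorm X⁻¹ +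
        frobNorm Y⁻¹ * frobNorm S * frobNorm (X⁻¹ - Y⁻¹) :=
        (frobNorm_add_le _ _).trans
          (add_le_add (frobNorm_mul_mul_le _ _ _) (frobNorm_mul_mul_le _ _ _))
    _ ≤ (L * frobNorm (X - Y)) * frobNorm S * (d / a) +
        (d / a) * frobNorm S * (L * frobNorm (X - Y)) := by gcongr
    _ = _ := by ring

lemma log_det_congruence {W Wi : Mat d} (h1 : Wi * W = 1) {v : Fin d → ℝ} (hv : ∀ i, 0 < v i) :
    Real.log (W * Matrix.diagonal v * W.transpose).det =
      Real.log (W * W.transpose).det + ∑ i, Real.log (v i) := by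
  have hW : W.det ≠ 0 := by
    intro h0
    have := congrArg Matrix.det h1
    simp [h0] at this
  rw [Matrix.det_mul, Matrix.det_mul, Matrix.det_mul, Matrix.det_diagonal, Matrix.det_transpose,
    ← Real.log_prod fun i _ => (hv i).ne', ← Real.log_mul (mul_ne_zero hW hW)
    (Finset.prod_ne_zero_iff.2 fun i _ => (hv i).ne')]
  congr 1
  ring

/-- In the common congruence basis the two sides are `∑ log (v i)` and `∑ (v i - 1)`. -/
lemma log_det_sub_le {X Y : Mat d} (hX : X ∈ PD d) (hY : Y ∈ PD d) :
    Real.log Y.det - Real.log X.det ≤ frobInner X⁻¹ (Y - X) := by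
  have hs := isSymm_inv hX
  obtain ⟨W, Wi, v, h1, h2, hv, hWX, hWY, -, -⟩ := exists_congruence hX hY
  have hX' : X = W * Matrix.diagonal (fun _ => (1 : ℝ)) * W.transpose := by
    rw [Matrix.diagonal_one, Matrix.mul_one, hWX]
  have hinv : X⁻¹ = Wi.transpose * Wi := by rw [hWX, inv_mul_transpose_self h1 h2]
  have hsub : Y - X = W * Matrix.diagonal (fun i => v i - 1) * W.transpose := by
    rw [← mul_diagonal_mul_transpose_sub, ← hX', hWY]
  have htr : frobInner X⁻¹ (Y - X) = ∑ i, (v i - 1) := by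
    rw [frobInner, hs.eq, hinv, hsub]
    calc _ = (Wi.transpose * ((Wi * W) * Matrix.diagonal (fun i => v i - 1) *
          W.transpose)).trace := by simp only [Matrix.mul_assoc]
      _ = (Matrix.diagonal (fun i => v i - 1) * (Wi * W).transpose).trace := by
        rw [h1, Matrix.one_mul, Matrix.trace_mul_comm, Matrix.mul_assoc, ← Matrix.transpose_mul, h1]
      _ = _ := by simp [h1, Matrix.trace_diagonal]
  rw [htr, hWY, log_det_congruence h1 hv, hWX, add_sub_cancel_left]
  exact Finset.sum_le_sum fun i _ => Real.log_le_sub_one_of_pos (hv i)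

lemma isSubgradient_neg_log_det :
    IsSubgradient (fun X : Mat d => -Real.log X.det) fun X => -X⁻¹ := by
  refine ⟨fun X hX => (isSymm_inv hX).neg, fun X hX Y hY => ?_⟩
  rw [frobInner_neg_left]
  linarith [log_det_sub_le hX hY]

lemma half_add_mem {X T : Mat d} (hX : X ∈ PD d) (hT : T ∈ PD d) :
    (1 / 2 : ℝ) • (X + T) ∈ PD d := by
  have h : (X + T).PosDef := Matrix.PosDef.add hX hT
  exact h.smul (by norm_num : (0 : ℝ) < 1 / 2)

lemma isSubgradient_neg_log_det_half_add {T : Mat d} (hT : T ∈ PD d) :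
    IsSubgradient (fun X : Mat d => -Real.log ((1 / 2 : ℝ) • (X + T)).det)
      fun X => -(X + T)⁻¹ := by
  refine ⟨fun X hX => (isSymm_inv (Matrix.PosDef.add hX hT)).neg, fun X hX Y hY => ?_⟩
  have h1 := log_det_sub_le (half_add_mem hX hT) (half_add_mem hY hT)
  have hXT : X + T ∈ PD d := Matrix.PosDef.add hX hT
  have h2 : ((1 / 2 : ℝ) • (X + T))⁻¹ = (2 : ℝ) • (X + T)⁻¹ := by
    apply Matrix.inv_eq_right_inv
    rw [Matrix.smul_mul, Matrix.mul_smul, mul_inv_cancel_of_mem hXT, smul_smul]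
    norm_num
  rw [h2, ← smul_sub, add_sub_add_right_eq_sub, frobInner_smul_left, frobInner_smul_right] at h1
  rw [frobInner_neg_left]
  linarith

/-- The gap in the subgradient inequality is exactly the trace of `S` times `(X⁻¹ - Y⁻¹) * Y * (X⁻¹
- Y⁻¹)`, a product of positive semidefinite matrices. -/
lemma isSubgradient_trace_mul_inv {S : Mat d} (hS : S.PosSemidef) :
    IsSubgradient (fun X : Mat d => (S * X⁻¹).trace) fun X => -(X⁻¹ * S * X⁻¹) := by
  have hSs : S.IsSymm := hS.1
  have hsymm : ∀ X ∈ PD d, (X⁻¹ * S * X⁻¹).IsSymm := by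
    intro X hX
    rw [Matrix.IsSymm, Matrix.transpose_mul, Matrix.transpose_mul, (isSymm_inv hX).eq, hSs.eq,
      Matrix.mul_assoc]
  refine ⟨fun X hX => (hsymm X hX).neg, fun X hX Y hY => ?_⟩
  have hP : ((X⁻¹ - Y⁻¹) * Y * (X⁻¹ - Y⁻¹)).PosSemidef := by
    have h := (Matrix.PosDef.posSemidef (M := Y) hY).conjTranspose_mul_mul_same (X⁻¹ - Y⁻¹)
    rwa [show (X⁻¹ - Y⁻¹).conjTranspose = X⁻¹ - Y⁻¹ from
      ((isSymm_inv hX).sub (isSymm_inv hY)).eq] at h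
  have h1 := trace_mul_nonneg hS hP
  have e : (X⁻¹ - Y⁻¹) * Y * (X⁻¹ - Y⁻¹) = X⁻¹ * (Y - X) * X⁻¹ - X⁻¹ + Y⁻¹ := by
    have a1 := inv_mul_cancel_of_mem hX
    have a2 := inv_mul_cancel_of_mem hY
    have a3 := mul_inv_cancel_of_mem hY
    simp only [Matrix.sub_mul, Matrix.mul_sub, a1, a2, Matrix.one_mul, Matrix.mul_assoc, a3,
      Matrix.mul_one]
    abel
  have e2 : frobInner (X⁻¹ * S * X⁻¹) (Y - X) = (S * (X⁻¹ * (Y - X) * X⁻¹)).trace := by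
    rw [frobInner, (hsymm X hX).eq, Matrix.mul_assoc, Matrix.mul_assoc, Matrix.trace_mul_comm]
    simp only [Matrix.mul_assoc]
  rw [e, Matrix.mul_add, Matrix.mul_sub, Matrix.trace_add, Matrix.trace_sub] at h1
  rw [frobInner_neg_left, e2]
  linarith

end Calculus

/-! ### The difference-of-convex structure of the likelihood -/

section OptLik

variable {S T : Mat d} {β : ℝ}

/-- The gradient of the convex part of `optLik`. -/
noncomputable def optLikGradF (S : Mat d) (β : ℝ) (X : Mat d) : Mat d :=
  -(X⁻¹ * S * X⁻¹) - (β / 2) • X⁻¹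

/-- The gradient of the subtracted part of `optLik`. -/
noncomputable def optLikGradH (T : Mat d) (β : ℝ) (X : Mat d) : Mat d :=
  -X⁻¹ - β • (X + T)⁻¹

lemma log_det_mul_of_mem {X T : Mat d} (hX : X ∈ PD d) (hT : T ∈ PD d) :
    Real.log (X * T).det = Real.log X.det + Real.log T.det := by
  rw [Matrix.det_mul, Real.log_mul (Matrix.PosDef.det_pos (A := X) hX).ne'
    (Matrix.PosDef.det_pos (A := T) hT).ne']

lemma isSubgradient_optLikF (hS : S.PosSemidef) (hT : T ∈ PD d) (hβ : 0 < β) :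
    IsSubgradient (optLikF S T β) (optLikGradF S β) := by
  refine ((isSubgradient_trace_mul_inv hS).add (isSubgradient_neg_log_det.smul
    (half_pos hβ).le)).congr_add_const (-(β / 2 * Real.log T.det)) (fun X hX => ?_) fun X => ?_
  · rw [optLikF, log_det_mul_of_mem hX hT]
    ring
  · rw [optLikGradF, smul_neg, sub_eq_add_neg]

lemma isSubgradient_optLikH (hT : T ∈ PD d) (hβ : 0 < β) :
    IsSubgradient (optLikH T β) (optLikGradH T β) := by
  refine (isSubgradient_neg_log_det.add ((isSubgradient_neg_log_det_half_add hT).smul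
    hβ.le)).congr_add_const 0 (fun X hX => ?_) fun X => ?_
  · rw [optLikH]
    ring
  · rw [optLikGradH, smul_neg, sub_eq_add_neg]

lemma lipOnBoxes_optLikGradF (S : Mat d) (β : ℝ) : LipOnBoxes (optLikGradF S β) := by
  have := ((lipOnBoxes_inv_mul_mul_inv S).smul (-1)).add (lipOnBoxes_inv.smul (-(β / 2)))
  convert this using 2 with X
  rw [optLikGradF, neg_one_smul, neg_smul, sub_eq_add_neg]

lemma lipOnBoxes_optLikGradH (hT : T ∈ PD d) (β : ℝ) : LipOnBoxes (optLikGradH T β) := by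
  have hT' : T.PosSemidef := Matrix.PosDef.posSemidef (M := T) hT
  have := ((lipOnBoxes_inv (d := d)).smul (-1)).add ((lipOnBoxes_inv_add hT').smul (-β))
  convert this using 2 with X
  rw [optLikGradH, neg_one_smul, neg_smul, sub_eq_add_neg]

lemma optLik_eq_sub (S T : Mat d) (β : ℝ) (X : Mat d) :
    optLik S T β X = optLikF S T β X - optLikH T β X := by
  simp only [optLik, regularized, gaussNLL, sDiv, optLikF, optLikH]
  ring

lemma isDC_optLik (hS : S.PosSemidef) (hT : T ∈ PD d) (hβ : 0 < β) :
    IsDC (optLik S T β) (optLikF S T β) (optLikH T β) where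
  convex_f := (isSubgradient_optLikF hS hT hβ).convexOn
  convex_h := (isSubgradient_optLikH hT hβ).convexOn
  smooth_h := (isSubgradient_optLikH hT hβ).smoothOnPD (lipOnBoxes_optLikGradH hT β).locLip
  eq_sub X _ := optLik_eq_sub S T β X

end OptLik

/-! ### Expansion of `det (diagonal x + N)` -/

section DetExpansion

/-- The matrix `N` with its rows in `I` replaced by rows of the identity. -/
def replaceRows (N : Mat d) (I : Finset (Fin d)) : Mat d :=
  Matrix.of fun i j => if i ∈ I then (1 : Mat d) i j else N i j

/-- The determinant is multilinear in the rows; `I` is the set of rows taken from the diagonal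
summand. -/
lemma det_diagonal_add (x : Fin d → ℝ) (N : Mat d) :
    (Matrix.diagonal x + N).det =
      ∑ I : Finset (Fin d), (∏ i ∈ I, x i) * (replaceRows N I).det := by
  have h1 := (Matrix.detRowAlternating (n := Fin d) (R := ℝ)).toMultilinearMap.map_add_univ
    (Matrix.diagonal x) N
  refine h1.trans (Finset.sum_congr rfl fun I _ => ?_)
  have h2 := (Matrix.detRowAlternating (n := Fin d) (R := ℝ)).toMultilinearMap.map_piecewise_smul
    x (replaceRows N I) I
  refine Eq.trans ?_ h2
  congr 1
  funext i
  funext j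
  change (if i ∈ I then Matrix.diagonal x i else N i) j =
    (if i ∈ I then x i • replaceRows N I i else replaceRows N I i) j
  by_cases hi : i ∈ I
  · rw [if_pos hi, if_pos hi, Pi.smul_apply, replaceRows, Matrix.of_apply, if_pos hi,
      Matrix.diagonal_apply, Matrix.one_apply]
    split_ifs <;> simp
  · rw [if_neg hi, if_neg hi, replaceRows, Matrix.of_apply, if_neg hi]

/-- The matrix is block triangular with an identity block on `I`, so its determinant is the
principal minor of `N` on the complement. -/
lemma det_replaceRows_pos {N : Mat d} (hN : N.PosDef) (I : Finset (Fin d)) :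
    0 < (replaceRows N I).det := by
  have hrow : ∀ i ∈ I, ∀ j, replaceRows N I i j = (1 : Mat d) i j := by
    intro i hi j
    rw [replaceRows, Matrix.of_apply, if_pos hi]
  have hrow' : ∀ i ∉ I, ∀ j, replaceRows N I i j = N i j := by
    intro i hi j
    rw [replaceRows, Matrix.of_apply, if_neg hi]
  rw [Matrix.twoBlockTriangular_det' _ (fun i => i ∈ I) fun i hi j hj => by
    rw [hrow i hi, Matrix.one_apply_ne (ne_of_mem_of_not_mem hi hj)]]
  have h1 : (replaceRows N I).toSquareBlockProp (fun i => i ∈ I) = 1 := by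
    ext i j
    rw [Matrix.toSquareBlockProp_def, Matrix.of_apply, hrow _ i.2, Matrix.one_apply,
      Matrix.one_apply]
    simp only [Subtype.ext_iff]
  have h2 : (replaceRows N I).toSquareBlockProp (fun i => i ∉ I) =
      N.submatrix Subtype.val Subtype.val := by
    ext i j
    rw [Matrix.toSquareBlockProp_def, Matrix.of_apply, hrow' _ i.2, Matrix.submatrix_apply]
  rw [h1, h2, @Matrix.det_one _ _ (_) _ _, one_mul]
  exact (hN.submatrix Subtype.val_injective).det_pos

end DetExpansion

/-! ### Convexity of log-sum-exp and its equality case -/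

section LogSumExp

variable {ι : Type*} [Fintype ι]

lemma convexOn_sum_exp {c : ι → ℝ} (hc : ∀ i, 0 ≤ c i) (m : ι → ℝ) :
    ConvexOn ℝ Set.univ fun t : ℝ => ∑ i, c i * Real.exp (t * m i) := by
  refine ⟨convex_univ, fun x _ y _ s t hs ht hst => ?_⟩
  simp only [smul_eq_mul, Finset.mul_sum, ← Finset.sum_add_distrib]
  refine Finset.sum_le_sum fun i _ => ?_
  have := convexOn_exp.2 (Set.mem_univ (x * m i)) (Set.mem_univ (y * m i)) hs ht hst
  simp only [smul_eq_mul] at this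
  have e : (s * x + t * y) * m i = s * (x * m i) + t * (y * m i) := by ring
  rw [e]
  calc _ ≤ c i * (s * Real.exp (x * m i) + t * Real.exp (y * m i)) :=
        mul_le_mul_of_nonneg_left this (hc i)
    _ = _ := by ring

lemma sum_exp_pos [Nonempty ι] {a : ι → ℝ} (ha : ∀ i, 0 < a i) (m : ι → ℝ) (t : ℝ) :
    0 < ∑ i, a i * Real.exp (t * m i) :=
  Finset.sum_pos (fun i _ => mul_pos (ha i) (Real.exp_pos _)) Finset.univ_nonempty

/-- Shifting the exponents by `p` and `q` normalizes both endpoint sums to `1`; termwise convexity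
of `exp` then bounds the intermediate sum by `1`. -/
lemma convexOn_log_sum_exp [Nonempty ι] {a : ι → ℝ} (ha : ∀ i, 0 < a i) (m : ι → ℝ) :
    ConvexOn ℝ Set.univ fun t : ℝ => Real.log (∑ i, a i * Real.exp (t * m i)) := by
  refine ⟨convex_univ, fun x _ y _ s t hs ht hst => ?_⟩
  have hx := sum_exp_pos ha m x
  have hy := sum_exp_pos ha m y
  set p := Real.log (∑ i, a i * Real.exp (x * m i)) with hp
  set q := Real.log (∑ i, a i * Real.exp (y * m i)) with hq
  simp only [smul_eq_mul]
  rw [Real.log_le_iff_le_exp (sum_exp_pos ha m _)]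
  have hsum : ∀ (z r : ℝ), ∑ i, a i * Real.exp (z * m i - r) =
      (∑ i, a i * Real.exp (z * m i)) * Real.exp (-r) := by
    intro z r
    rw [Finset.sum_mul]
    refine Finset.sum_congr rfl fun i _ => ?_
    rw [sub_eq_add_neg, Real.exp_add, mul_assoc]
  have hp1 : ∑ i, a i * Real.exp (x * m i - p) = 1 := by
    rw [hsum, Real.exp_neg, hp, Real.exp_log hx, mul_inv_cancel₀ hx.ne']
  have hq1 : ∑ i, a i * Real.exp (y * m i - q) = 1 := by
    rw [hsum, Real.exp_neg, hq, Real.exp_log hy, mul_inv_cancel₀ hy.ne']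
  have key : ∑ i, a i * Real.exp ((s * x + t * y) * m i - (s * p + t * q)) ≤ 1 := by
    calc _ ≤ ∑ i, (s * (a i * Real.exp (x * m i - p)) + t * (a i * Real.exp (y * m i - q))) := by
          refine Finset.sum_le_sum fun i _ => ?_
          have := convexOn_exp.2 (Set.mem_univ (x * m i - p)) (Set.mem_univ (y * m i - q)) hs ht hst
          simp only [smul_eq_mul] at this
          have e : (s * x + t * y) * m i - (s * p + t * q) =
            s * (x * m i - p) + t * (y * m i - q) := by ring
          rw [e]
          calc _ ≤ a i * (s * Real.exp (x * m i - p) + t * Real.exp (y * m i - q)) :=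
                mul_le_mul_of_nonneg_left this (ha i).le
            _ = _ := by ring
      _ = 1 := by
          rw [Finset.sum_add_distrib, ← Finset.mul_sum, ← Finset.mul_sum, hp1, hq1]
          linarith
  rw [hsum, Real.exp_neg, ← div_eq_mul_inv, div_le_one (Real.exp_pos _)] at key
  exact key

/-- Equality in midpoint log-convexity forces all exponents to coincide. -/
lemma exponents_eq_of_midpoint [Nonempty ι] {a : ι → ℝ} (ha : ∀ i, 0 < a i) (m : ι → ℝ)
    (h : (Real.log (∑ i, a i * Real.exp (0 * m i)) + Real.log (∑ i, a i * Real.exp (1 * m i))) / 2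
      ≤ Real.log (∑ i, a i * Real.exp (1 / 2 * m i))) (i j : ι) : m i = m j := by
  have h0 := sum_exp_pos ha m 0
  have h1 := sum_exp_pos ha m 1
  have h2 := sum_exp_pos ha m (1 / 2)
  set y : ι → ℝ := fun i => Real.exp (1 / 2 * m i) with hy
  have e0 : ∑ i, a i * Real.exp (0 * m i) = ∑ i, a i := by simp
  have e1 : ∑ i, a i * Real.exp (1 * m i) = ∑ i, a i * y i ^ 2 := by
    refine Finset.sum_congr rfl fun i _ => ?_
    rw [hy, ← Real.exp_nat_mul]
    congr 2
    push_cast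
    ring
  rw [e0] at h0 h
  rw [e1] at h1 h
  -- The hypothesis is Cauchy–Schwarz reversed. Hence the weighted variance in `hvar` vanishes and
  -- `y` is constant.
  have hle : (∑ i, a i) * (∑ i, a i * y i ^ 2) ≤ (∑ i, a i * y i) ^ 2 := by
    rw [← Real.log_le_log_iff (by positivity) (by positivity), Real.log_mul h0.ne' h1.ne',
      Real.log_pow]
    push_cast
    linarith
  set A := ∑ i, a i with hA
  set B := ∑ i, a i * y i with hB
  have hvar : ∑ i, a i * (A * y i - B) ^ 2 = A * (A * (∑ i, a i * y i ^ 2) - B ^ 2) := by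
    have : ∀ i, a i * (A * y i - B) ^ 2 =
        A ^ 2 * (a i * y i ^ 2) - 2 * A * B * (a i * y i) + B ^ 2 * a i := fun i => by ring
    simp only [this, Finset.sum_add_distrib, Finset.sum_sub_distrib, ← Finset.mul_sum]
    rw [← hA, ← hB]
    ring
  have hnonpos : ∑ i, a i * (A * y i - B) ^ 2 ≤ 0 := by
    rw [hvar]
    exact mul_nonpos_of_nonneg_of_nonpos h0.le (sub_nonpos.2 hle)
  have hnn : ∀ i ∈ Finset.univ, 0 ≤ a i * (A * y i - B) ^ 2 :=
    fun i _ => mul_nonneg (ha i).le (sq_nonneg _)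
  have hzero := (Finset.sum_eq_zero_iff_of_nonneg hnn).1
    (le_antisymm hnonpos (Finset.sum_nonneg hnn))
  have hyi : ∀ i, A * y i = B := by
    intro i
    have := hzero i (Finset.mem_univ i)
    have h3 := (mul_eq_zero.1 this).resolve_left (ha i).ne'
    exact sub_eq_zero.1 (pow_eq_zero_iff two_ne_zero |>.1 h3)
  have hyy : y i = y j := mul_left_cancel₀ h0.ne' ((hyi i).trans (hyi j).symm)
  have := Real.exp_injective hyy
  linarith

end LogSumExp

/-! ### Geodesic convexity and uniqueness of the minimizer -/

section GConvexity

variable {S T : Mat d} {β : ℝ}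

lemma trace_mul_congruence (S Wi : Mat d) (w : Fin d → ℝ) :
    (S * (Wi.transpose * Matrix.diagonal w * Wi)).trace =
      ∑ i, (Wi * S * Wi.transpose) i i * w i := by
  have : (S * (Wi.transpose * Matrix.diagonal w * Wi)).trace =
      (Wi * S * Wi.transpose * Matrix.diagonal w).trace := by
    rw [← Matrix.mul_assoc, Matrix.trace_mul_comm]
    simp only [Matrix.mul_assoc]
  rw [this, Matrix.trace]
  simp only [Matrix.diag_apply, Matrix.mul_diagonal]

/-- The objective along a geodesic. -/
lemma exists_optLik_geodesic (hS : S.PosSemidef) (hT : T ∈ PD d) (β : ℝ) {A B : Mat d}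
    (hA : A ∈ PD d) (hB : B ∈ PD d) :
    ∃ (c p : Fin d → ℝ) (a : Finset (Fin d) → ℝ) (ρ κ : ℝ), (∀ i, 0 ≤ c i) ∧ (∀ I, 0 < a I) ∧
      (∀ t, optLik S T β (geodesic A B t) = ∑ i, c i * Real.exp (t * -p i) + ρ * t +
        β * Real.log (∑ I, a I * Real.exp (t * ∑ i ∈ I, p i)) + κ) ∧
      ((∀ i, p i = 0) → A = B) := by
  obtain ⟨W, Wi, v, h1, h2, hv, hWA, hWB, hg, -⟩ := exists_congruence hA hB
  -- `N` is `T` in the congruence basis, so that the geodesic plus `T` equals `W * (diagonal (v ^ t)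
  -- + N) * Wᵀ`.
  set N := Wi * T * Wi.transpose with hN
  have hWiu : IsUnit Wi := IsUnit.of_mul_eq_one _ h1
  have hNd : N.PosDef := (Matrix.IsUnit.posDef_star_right_conjugate_iff hWiu).2 hT
  have hcS : (Wi * S * Wi.transpose).PosSemidef := hS.mul_mul_conjTranspose_same Wi
  have hTN : T = W * N * W.transpose := by
    calc T = (W * Wi) * T * (W * Wi).transpose := by simp [h2]
      _ = _ := by rw [Matrix.transpose_mul, hN]; simp only [Matrix.mul_assoc]
  set κ₀ := Real.log (W * W.transpose).det with hκ₀
  have hdetW : 0 < (W * W.transpose).det := hWA ▸ Matrix.PosDef.det_pos (A := A) hA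
  refine ⟨fun i => (Wi * S * Wi.transpose) i i, fun i => Real.log (v i),
    fun I => (replaceRows N I).det, (1 - β / 2) * ∑ i, Real.log (v i),
    κ₀ + β * (Real.log ((1 / 2 : ℝ) ^ d) + κ₀) - β / 2 * (κ₀ + Real.log T.det),
    fun i => hcS.diag_nonneg, det_replaceRows_pos hNd, fun t => ?_, fun hp => ?_⟩
  · have hvt : ∀ i, 0 < v i ^ t := fun i => Real.rpow_pos_of_pos (hv i) t
    have e1 : (S * (geodesic A B t)⁻¹).trace =
        ∑ i, (Wi * S * Wi.transpose) i i * Real.exp (t * -Real.log (v i)) := by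
      rw [hg, inv_congruence h1 h2 hvt, trace_mul_congruence]
      refine Finset.sum_congr rfl fun i _ => ?_
      rw [Real.rpow_def_of_pos (hv i), ← Real.exp_neg]
      congr 2
      ring
    have e2 : Real.log (geodesic A B t).det = κ₀ + t * ∑ i, Real.log (v i) := by
      rw [hg, log_det_congruence h1 hvt, Finset.mul_sum]
      simp only [Real.log_rpow (hv _)]
      rfl
    have e3 : Real.log ((1 / 2 : ℝ) • (geodesic A B t + T)).det =
        Real.log ((1 / 2 : ℝ) ^ d) + κ₀ + Real.log (∑ I : Finset (Fin d), (replaceRows N I).det *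
          Real.exp (t * ∑ i ∈ I, Real.log (v i))) := by
      have hsum : geodesic A B t + T =
          W * (Matrix.diagonal (fun i => v i ^ t) + N) * W.transpose := by
        rw [hg, Matrix.mul_add, Matrix.add_mul, ← hTN]
      have hdet : (Matrix.diagonal (fun i => v i ^ t) + N).det =
          ∑ I : Finset (Fin d), (replaceRows N I).det *
            Real.exp (t * ∑ i ∈ I, Real.log (v i)) := by
        rw [det_diagonal_add]
        refine Finset.sum_congr rfl fun I _ => ?_
        rw [mul_comm, Finset.mul_sum, Real.exp_sum]
        congr 1
        refine Finset.prod_congr rfl fun i _ => ?_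
        rw [Real.rpow_def_of_pos (hv i), mul_comm]
      have hpos := sum_exp_pos (det_replaceRows_pos hNd) (fun I => ∑ i ∈ I, Real.log (v i)) t
      have hd2 : ((1 / 2 : ℝ) • (geodesic A B t + T)).det = (1 / 2 : ℝ) ^ d *
          (W * W.transpose).det * (Matrix.diagonal (fun i => v i ^ t) + N).det := by
        rw [Matrix.det_smul, hsum, Matrix.det_mul, Matrix.det_mul, Matrix.det_mul,
          Fintype.card_fin]
        ring
      rw [hd2, hdet, Real.log_mul (by positivity) hpos.ne', Real.log_mul (by positivity) hdetW.ne']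
    have e4 := log_det_mul_of_mem (geodesic_mem hA hB t) hT
    simp only [optLik, regularized, gaussNLL, sDiv]
    rw [e4, e1, e2, e3]
    ring
  · have hv1 : v = fun _ => 1 := funext fun i => by
      rcases Real.log_eq_zero.1 (hp i) with h | h | h
      · exact absurd h (hv i).ne'
      · exact h
      · linarith [hv i]
    rw [hWA, hWB, hv1, Matrix.diagonal_one, Matrix.mul_one]

lemma gConvex_optLik (hS : S.PosSemidef) (hT : T ∈ PD d) (hβ : 0 < β) :
    GConvex (optLik S T β) := by
  intro A hA B hB
  obtain ⟨c, p, a, ρ, κ, hc, ha, hφ, -⟩ := exists_optLik_geodesic hS hT β hA hB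
  simp only [hφ]
  have hlin : ConvexOn ℝ Set.univ fun t : ℝ => ρ * t :=
    (LinearMap.mulLeft ℝ ρ).convexOn convex_univ
  have h := ((((convexOn_sum_exp hc fun i => -p i).add hlin).add
    ((convexOn_log_sum_exp ha fun I => ∑ i ∈ I, p i).smul hβ.le)).add_const κ).subset
    (Set.subset_univ (Set.Icc (0 : ℝ) 1)) (convex_Icc 0 1)
  exact h

/-- At the geodesic midpoint of two minimizers the value cannot drop below their common value. The
other terms being convex or linear, the log-sum-exp must attain equality in midpoint convexity, so
all its exponents agree. -/
lemma isMinimizer_optLik_unique (hS : S.PosSemidef) (hT : T ∈ PD d) (hβ : 0 < β) {A B : Mat d}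
    (hA : IsMinimizer (optLik S T β) A) (hB : IsMinimizer (optLik S T β) B) : A = B := by
  obtain ⟨c, p, a, ρ, κ, hc, ha, hφ, hp⟩ := exists_optLik_geodesic hS hT β hA.1 hB.1
  have h0 := hφ 0
  have h1 := hφ 1
  have h2 := hφ (1 / 2)
  rw [geodesic_zero hA.1 hB.1] at h0
  rw [geodesic_one hA.1 hB.1] at h1
  have hm := hA.2 _ (geodesic_mem hA.1 hB.1 (1 / 2))
  have hAB := hA.2 _ hB.1
  have hBA := hB.2 _ hA.1
  have hconv := (convexOn_sum_exp hc fun i => -p i).2 (Set.mem_univ 0) (Set.mem_univ 1)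
    (by norm_num : (0 : ℝ) ≤ 1 / 2) (by norm_num : (0 : ℝ) ≤ 1 / 2) (by norm_num)
  simp only [smul_eq_mul, mul_zero, mul_one, zero_add] at hconv
  apply hp
  have hmid : (Real.log (∑ I, a I * Real.exp (0 * ∑ i ∈ I, p i)) +
      Real.log (∑ I, a I * Real.exp (1 * ∑ i ∈ I, p i))) / 2
      ≤ Real.log (∑ I, a I * Real.exp (1 / 2 * ∑ i ∈ I, p i)) := by
    refine le_of_mul_le_mul_left ?_ hβ
    linarith
  intro i
  -- The exponents of `{i}` and `∅` are `p i` and `0`.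
  have := exponents_eq_of_midpoint ha (fun I => ∑ i ∈ I, p i) hmid {i} ∅
  simpa using this

end GConvexity

/-! ### Coercivity of the likelihood -/

section Coercivity

variable {S T : Mat d} {β : ℝ}

/-- For `x ≥ 1` the logarithms add up to at least `(1 + β / 2) log x`. For `x ≤ 1` the term with `τ`
is bounded below, and growth comes from `σ / x` if `σ > 0` or from the negative coefficient `1 - β /
2` if `β > 2`. -/
lemma exists_scalar_coercive {σ τ β : ℝ} (hσ : 0 ≤ σ) (hτ : 0 < τ) (hβ : 0 < β)
    (h : 0 < σ ∨ 2 < β) : ∃ c₁ c₂ : ℝ, 0 < c₁ ∧ ∀ x : ℝ, 0 < x →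
      c₁ * |Real.log x| - c₂ ≤ σ * x⁻¹ + (1 - β / 2) * Real.log x + β * Real.log (x + τ) := by
  have hbig : ∀ x : ℝ, 1 ≤ x →
      Real.log x ≤ σ * x⁻¹ + (1 - β / 2) * Real.log x + β * Real.log (x + τ) := by
    intro x hx
    have h1 : Real.log x ≤ Real.log (x + τ) := Real.log_le_log (by linarith) (by linarith)
    have h2 : 0 ≤ Real.log x := Real.log_nonneg hx
    have h3 : 0 ≤ σ * x⁻¹ := by positivity
    nlinarith
  have hsmall : ∀ x : ℝ, 0 < x → β * Real.log τ ≤ β * Real.log (x + τ) := fun x hx =>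
    mul_le_mul_of_nonneg_left (Real.log_le_log hτ (by linarith)) hβ.le
  rcases h with hσ' | hβ2
  · refine ⟨1, |β * Real.log τ| + |2 + 2 * Real.log (σ / 2)|, one_pos, fun x hx => ?_⟩
    rcases le_total 1 x with h1 | h1
    · rw [abs_of_nonneg (Real.log_nonneg h1)]
      linarith [hbig x h1, abs_nonneg (β * Real.log τ), abs_nonneg (2 + 2 * Real.log (σ / 2))]
    · have hlog : Real.log x ≤ 0 := Real.log_nonpos hx.le h1
      rw [abs_of_nonpos hlog]
      -- The factor `2` in front of `log x` leaves `|log x|` after paying for `(1 - β / 2) log x ≥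
      -- log x`.
      have h2 : 2 + 2 * Real.log (σ / 2) - 2 * Real.log x ≤ σ * x⁻¹ := by
        have h3 := Real.log_le_sub_one_of_pos (by positivity : 0 < σ / 2 * x⁻¹)
        rw [Real.log_mul (by positivity) (by positivity), Real.log_inv] at h3
        linarith
      have := neg_abs_le (β * Real.log τ)
      have := neg_abs_le (2 + 2 * Real.log (σ / 2))
      nlinarith [hsmall x hx]
  · refine ⟨min 1 (β / 2 - 1), |β * Real.log τ|, lt_min one_pos (by linarith), fun x hx => ?_⟩
    rcases le_total 1 x with h1 | h1
    · have hl := Real.log_nonneg h1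
      rw [abs_of_nonneg hl]
      have := mul_le_mul_of_nonneg_right (min_le_left 1 (β / 2 - 1)) hl
      linarith [hbig x h1, abs_nonneg (β * Real.log τ)]
    · have hlog : Real.log x ≤ 0 := Real.log_nonpos hx.le h1
      rw [abs_of_nonpos hlog]
      have h3 : 0 ≤ σ * x⁻¹ := by positivity
      have := mul_le_mul_of_nonneg_right (min_le_right 1 (β / 2 - 1)) (neg_nonneg.2 hlog)
      have := neg_abs_le (β * Real.log τ)
      nlinarith [hsmall x hx]

lemma log_det_le_log_det {X Y : Mat d} (hX : X ∈ PD d) (hY : Y ∈ PD d)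
    (h : (Y - X).PosSemidef) : Real.log X.det ≤ Real.log Y.det := by
  have h1 := log_det_sub_le hY hX
  have h2 := trace_mul_nonneg (Matrix.PosDef.inv (M := Y) hY).posSemidef h
  rw [← neg_sub Y X, frobInner_neg_right, frobInner, (isSymm_inv hY).eq] at h1
  linarith

/-- The bounds `S ≥ σ` and `T ≥ τ`, with monotonicity of trace and `log det`, reduce the objective
from below to a sum of scalar functions of the eigenvalues of `X`; each of these is coercive in
`|log (v i)|`. -/
lemma exists_box_of_optLik_le (hS : S.PosSemidef) (hT : T ∈ PD d) (hβ : 0 < β)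
    (h : S.PosDef ∨ 2 < β) (M : ℝ) :
    ∃ a b : ℝ, 0 < a ∧ ∀ X ∈ PD d, optLik S T β X ≤ M → X ∈ box d a b := by
  obtain ⟨τ, hτ, hTτ⟩ := exists_pos_posSemidef_sub (B := T) hT
  obtain ⟨σ, hσ, hSσ, hor⟩ : ∃ σ : ℝ, 0 ≤ σ ∧ (S - σ • (1 : Mat d)).PosSemidef ∧
      (0 < σ ∨ 2 < β) := by
    rcases h with hSd | hβ2
    · obtain ⟨σ, hσ, hSσ⟩ := exists_pos_posSemidef_sub hSd
      exact ⟨σ, hσ.le, hSσ, Or.inl hσ⟩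
    · exact ⟨0, le_rfl, by simpa using hS, Or.inr hβ2⟩
  obtain ⟨c₁, c₂, hc₁, hc⟩ := exists_scalar_coercive hσ hτ hβ hor
  set κ : ℝ := β * Real.log ((1 / 2 : ℝ) ^ d) - β / 2 * Real.log T.det with hκ
  set C : ℝ := (M - κ + d * c₂) / c₁ with hC
  refine ⟨Real.exp (-C), d * Real.exp C, Real.exp_pos _, fun X hX hXM => ?_⟩
  obtain ⟨U, v, h1, h2, hv, hXU, -⟩ := exists_diagonalization_of_posDef (M := X) hX
  have e1 : σ * ∑ i, (v i)⁻¹ ≤ (S * X⁻¹).trace := by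
    have hinv : X⁻¹.trace = ∑ i, (v i)⁻¹ := by
      rw [hXU, inv_congruence h1 h2 hv, Matrix.transpose_transpose,
        trace_mul_diagonal_mul_transpose h1]
    have := trace_mul_nonneg hSσ (Matrix.PosDef.inv (M := X) hX).posSemidef
    rw [Matrix.sub_mul, Matrix.trace_sub, Matrix.smul_mul, Matrix.one_mul, Matrix.trace_smul,
      hinv, smul_eq_mul] at this
    linarith
  have e2 : Real.log X.det = ∑ i, Real.log (v i) := by
    rw [hXU, log_det_congruence h1 hv, h2, Matrix.det_one, Real.log_one, zero_add]
  have e3 : Real.log ((1 / 2 : ℝ) ^ d) + ∑ i, Real.log (v i + τ) ≤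
      Real.log ((1 / 2 : ℝ) • (X + T)).det := by
    have hY : X + τ • (1 : Mat d) = U * Matrix.diagonal (fun i => v i + τ) * U.transpose := by
      rw [← mul_diagonal_const_mul_transpose h2 τ, hXU, mul_diagonal_mul_transpose_add]
    have hτ1 : τ • (1 : Mat d) ∈ PD d := Matrix.PosDef.one.smul hτ
    have hvτ : ∀ i, 0 < v i + τ := fun i => add_pos (hv i) hτ
    have hle := log_det_le_log_det (half_add_mem hX hτ1) (half_add_mem hX hT) (by
      rw [← smul_sub, add_sub_add_left_eq_sub]
      exact hTτ.smul (by norm_num : (0 : ℝ) ≤ 1 / 2))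
    refine le_trans (le_of_eq ?_) hle
    have hdet : 0 < (X + τ • (1 : Mat d)).det :=
      Matrix.PosDef.det_pos (A := X + τ • (1 : Mat d)) (Matrix.PosDef.add hX hτ1)
    rw [Matrix.det_smul, Fintype.card_fin, Real.log_mul (by positivity) hdet.ne', hY,
      log_det_congruence h1 hvτ, h2, Matrix.det_one, Real.log_one, zero_add]
  have e4 := log_det_mul_of_mem hX hT
  have hlow : κ + ∑ i, (σ * (v i)⁻¹ + (1 - β / 2) * Real.log (v i) +
      β * Real.log (v i + τ)) ≤ optLik S T β X := by
    simp only [optLik, regularized, gaussNLL, sDiv]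
    rw [e4, e2, Finset.sum_add_distrib, Finset.sum_add_distrib, ← Finset.mul_sum,
      ← Finset.mul_sum, ← Finset.mul_sum]
    have := mul_le_mul_of_nonneg_left e3 hβ.le
    nlinarith
  have hsum : c₁ * ∑ i, |Real.log (v i)| - d * c₂ ≤ ∑ i, (σ * (v i)⁻¹ +
      (1 - β / 2) * Real.log (v i) + β * Real.log (v i + τ)) := by
    calc _ = ∑ i, (c₁ * |Real.log (v i)| - c₂) := by
          rw [Finset.sum_sub_distrib, Finset.mul_sum]; simp
      _ ≤ _ := Finset.sum_le_sum fun i _ => hc (v i) (hv i)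
  have hbound : ∀ i, |Real.log (v i)| ≤ C := by
    intro i
    have h3 : |Real.log (v i)| ≤ ∑ i, |Real.log (v i)| :=
      Finset.single_le_sum (f := fun i => |Real.log (v i)|) (fun _ _ => abs_nonneg _)
        (Finset.mem_univ i)
    rw [hC, le_div_iff₀ hc₁]
    nlinarith
  refine ⟨?_, ?_⟩
  · rw [hXU, ← mul_diagonal_const_mul_transpose h2, mul_diagonal_mul_transpose_sub,
      posSemidef_mul_diagonal_mul_transpose_iff h1]
    intro i
    rw [sub_nonneg, ← Real.exp_log (hv i), Real.exp_le_exp]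
    exact (abs_le.1 (hbound i)).1
  · rw [hXU, trace_mul_diagonal_mul_transpose h1]
    calc ∑ i, v i ≤ ∑ _i : Fin d, Real.exp C := by
          refine Finset.sum_le_sum fun i _ => ?_
          rw [← Real.exp_log (hv i), Real.exp_le_exp]
          exact (abs_le.1 (hbound i)).2
      _ = d * Real.exp C := by simp

end Coercivity

/-! ### The gradient bounds the optimality gap -/

section GradientDomination

lemma LocLip.tendsto {g : Mat d → Mat d} (hg : LocLip g) {X : Mat d} (hX : X ∈ PD d)
    {u : ℕ → Mat d} (huP : ∀ k, u k ∈ PD d) (hu : Tendsto u atTop (𝓝 X)) :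
    Tendsto (fun k => g (u k)) atTop (𝓝 (g X)) := by
  obtain ⟨r, hr, L, hL⟩ := hg X hX
  have h0 : frobNorm (X - X) < r := by rw [sub_self, frobNorm_zero]; exact hr
  have h1 := (tendsto_frobNorm_sub X).comp hu
  have h2 : Tendsto (fun k => L * frobNorm (u k - X)) atTop (𝓝 0) := by
    simpa using h1.const_mul L
  refine tendsto_of_frobNorm (squeeze_zero' (Eventually.of_forall fun _ => frobNorm_nonneg _) ?_ h2)
  filter_upwards [h1.eventually_lt_const hr] with k hk
  exact hL _ (huP k) hk X hX h0

/-- For a g-convex difference of convex functions, the gradient bounds the optimality gap. -/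
lemma sub_le_frobNorm_grad_mul {φ f h : Mat d → ℝ} {gf gh : Mat d → Mat d} (hg : GConvex φ)
    (hf : IsSubgradient f gf) (hh : IsSubgradient h gh) (hl : LocLip gh)
    (hφ : ∀ X ∈ PD d, φ X = f X - h X) {A B : Mat d} {R : ℝ} (hA : A ∈ PD d) (hB : B ∈ PD d)
    (hR : riemDist A B ≤ R) :
    φ A - φ B ≤ frobNorm (gf A - gh A) * speedBound B R := by
  have hs : 0 ≤ speedBound B R := speedBound_nonneg hB ((frobNorm_nonneg _).trans hR)
  obtain ⟨r, hr, L, hL⟩ := hl A hA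
  have h0 : frobNorm (A - A) < r := by rw [sub_self, frobNorm_zero]; exact hr
  set s := speedBound B R with hsdef
  -- Linearizing `f` at `A` and `h` at the geodesic point `Z` bounds `φ Z` from below by subgradient
  -- inequalities alone. Replacing `gh Z` by `gh A` costs `O(t)`, which disappears in the limit
  -- after division by `t`.
  have key : ∀ᶠ t in 𝓝[>] (0 : ℝ),
      φ A - φ B ≤ (frobNorm (gf A - gh A) + |L| * (t * s)) * s := by
    have hsmall : ∀ᶠ t in 𝓝[>] (0 : ℝ), t * s < r := by
      have : Tendsto (fun t : ℝ => t * s) (𝓝[>] 0) (𝓝 (0 * s)) :=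
        ((continuous_id.mul continuous_const).tendsto 0).mono_left nhdsWithin_le_nhds
      rw [zero_mul] at this
      exact this.eventually_lt_const hr
    have hlt1 : ∀ᶠ t in 𝓝[>] (0 : ℝ), t < 1 := nhdsWithin_le_nhds (eventually_lt_nhds one_pos)
    filter_upwards [hsmall, hlt1, self_mem_nhdsWithin] with t htr ht1 ht0
    have ht0 : 0 < t := ht0
    set Z := geodesic A B t with hZ
    have hZP : Z ∈ PD d := geodesic_mem hA hB t
    have hspeed : frobNorm (Z - A) ≤ t * s := frobNorm_geodesic_sub_le hA hB hR ht0.le ht1.le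
    have hconv : φ Z ≤ (1 - t) * φ A + t * φ B := by
      have := (hg A hA B hB).2 (Set.left_mem_Icc.2 zero_le_one)
        (Set.right_mem_Icc.2 zero_le_one) (sub_nonneg.2 ht1.le) ht0.le (sub_add_cancel 1 t)
      simpa [geodesic_zero hA hB, geodesic_one hA hB, ← hZ] using this
    have h1 := hf.add_le A hA Z hZP
    have h2 := hh.add_le Z hZP A hA
    rw [← neg_sub Z A, frobInner_neg_right] at h2
    have h3 : frobNorm (gh A - gh Z) ≤ |L| * (t * s) := by
      refine (hL A hA h0 Z hZP (hspeed.trans_lt htr)).trans ?_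
      rw [frobNorm_sub_comm]
      exact mul_le_mul (le_abs_self L) hspeed (frobNorm_nonneg _) (abs_nonneg L)
    have h4 : -frobInner (gf A - gh Z) (Z - A) ≤
        (frobNorm (gf A - gh A) + |L| * (t * s)) * (t * s) := by
      refine (neg_le_abs _).trans ((frobInner_le _ _).trans ?_)
      have e : gf A - gh Z = (gf A - gh A) + (gh A - gh Z) := by abel
      have h5 : frobNorm (gf A - gh Z) ≤ frobNorm (gf A - gh A) + |L| * (t * s) := by
        rw [e]
        exact (frobNorm_add_le _ _).trans (add_le_add le_rfl h3)
      exact mul_le_mul h5 hspeed (frobNorm_nonneg _) ((frobNorm_nonneg _).trans h5)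
    rw [frobInner_sub_left] at h4
    have h6 : t * (φ A - φ B) ≤ t * ((frobNorm (gf A - gh A) + |L| * (t * s)) * s) := by
      have e1 := hφ A hA
      have e2 := hφ Z hZP
      linarith
    exact le_of_mul_le_mul_left h6 ht0
  have hlim : Tendsto (fun t : ℝ => (frobNorm (gf A - gh A) + |L| * (t * s)) * s) (𝓝[>] 0)
      (𝓝 ((frobNorm (gf A - gh A) + |L| * (0 * s)) * s)) := by
    have : Continuous fun t : ℝ => (frobNorm (gf A - gh A) + |L| * (t * s)) * s := by fun_prop
    exact (this.tendsto 0).mono_left nhdsWithin_le_nhds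
  have := ge_of_tendsto hlim key
  simpa using this

end GradientDomination

/-! ### Inexact minimization by gradient steps -/

section GradientSteps

variable {S T : Mat d} {β : ℝ}

lemma LipOnBoxes.exists_bound {g : Mat d → Mat d} (hg : LipOnBoxes g) {a : ℝ} (ha : 0 < a)
    (b : ℝ) : ∃ G : ℝ, 0 ≤ G ∧ ∀ X ∈ box d a b, frobNorm (g X) ≤ G := by
  rcases (box d a b).eq_empty_or_nonempty with h | ⟨Z, hZ⟩
  · exact ⟨0, le_rfl, fun X hX => by rw [h] at hX; exact hX.elim⟩
  · obtain ⟨L, hL0, hL⟩ := hg a b ha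
    have hn : ∀ X ∈ box d a b, frobNorm X ≤ b := fun X hX =>
      (frobNorm_le_trace (posSemidef_of_mem_box ha.le hX)).trans hX.2
    have hb : 0 ≤ b := (frobNorm_nonneg _).trans (hn Z hZ)
    refine ⟨L * (b + b) + frobNorm (g Z),
      add_nonneg (by positivity) (frobNorm_nonneg _), fun X hX => ?_⟩
    have h1 := hL X hX Z hZ
    have h2 : frobNorm (X - Z) ≤ b + b :=
      (frobNorm_sub_le _ _).trans (add_le_add (hn X hX) (hn Z hZ))
    calc frobNorm (g X) = frobNorm ((g X - g Z) + g Z) := by rw [sub_add_cancel]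
      _ ≤ frobNorm (g X - g Z) + frobNorm (g Z) := frobNorm_add_le _ _
      _ ≤ _ := add_le_add (h1.trans (mul_le_mul_of_nonneg_left h2 hL0)) le_rfl

lemma surrogate_optLik_eq (hT : T ∈ PD d) (hβ : 0 < β) (X : Mat d) {Y : Mat d} (hY : Y ∈ PD d) :
    surrogate (optLikF S T β) (optLikH T β) X Y =
      optLikF S T β X - optLikH T β Y - frobInner (optLikGradH T β Y) (X - Y) := by
  rw [surrogate, (isSubgradient_optLikH hT hβ).euclGrad_eq (lipOnBoxes_optLikGradH hT β).locLip hY]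

/-- Sufficient decrease of the surrogate under one short gradient step. -/
lemma exists_step_size (hS : S.PosSemidef) (hT : T ∈ PD d) (hβ : 0 < β) {a : ℝ} (ha : 0 < a)
    (b : ℝ) : ∃ ηmax : ℝ, 0 < ηmax ∧ ∀ X ∈ box d a b, ∀ Y ∈ box d a b, ∀ η : ℝ, 0 < η → η ≤ ηmax →
      X - η • (optLikGradF S β X - optLikGradH T β Y) ∈ PD d ∧
      surrogate (optLikF S T β) (optLikH T β)
        (X - η • (optLikGradF S β X - optLikGradH T β Y)) Y ≤
      surrogate (optLikF S T β) (optLikH T β) X Y -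
        η / 2 * frobNorm (optLikGradF S β X - optLikGradH T β Y) ^ 2 := by
  have hF := isSubgradient_optLikF hS hT hβ
  have hH := isSubgradient_optLikH hT hβ
  obtain ⟨G₁, hG₁, hG₁b⟩ := (lipOnBoxes_optLikGradF S β).exists_bound ha b
  obtain ⟨G₂, hG₂, hG₂b⟩ := (lipOnBoxes_optLikGradH hT β).exists_bound ha b
  have ha' : 0 < a - a / 2 := by linarith
  obtain ⟨Λ, hΛ, hΛL⟩ := lipOnBoxes_optLikGradF S β (a - a / 2) (b + d * (a / 2)) ha'
  -- The first bound gives `‖η D‖ ≤ a / 2`, so the step stays in the enlarged box where `Λ` is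
  -- valid. The second gives `Λ η ≤ 1 / 2`, which leaves half of `η ‖D‖²` as decrease.
  refine ⟨min (a / 2 / (G₁ + G₂ + 1)) (1 / (2 * (Λ + 1))), by positivity,
    fun X hX Y hY η hη hηmax => ?_⟩
  have hXP := box_subset_PD ha hX
  have hYP := box_subset_PD ha hY
  obtain ⟨hη1, hη2⟩ := le_min_iff.1 hηmax
  rw [le_div_iff₀ (by positivity)] at hη1 hη2
  set D := optLikGradF S β X - optLikGradH T β Y with hD
  have hDs : D.IsSymm := (hF.isSymm X hXP).sub (hH.isSymm Y hYP)
  have hD0 := frobNorm_nonneg D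
  have hDG : frobNorm D ≤ G₁ + G₂ :=
    (frobNorm_sub_le _ _).trans (add_le_add (hG₁b X hX) (hG₂b Y hY))
  have hZ : frobNorm (-(η • D)) ≤ a / 2 := by
    rw [frobNorm_neg, frobNorm_smul, abs_of_pos hη]
    nlinarith
  have hX'b : X - η • D ∈ box d (a - a / 2) (b + d * (a / 2)) := by
    rw [sub_eq_add_neg]
    exact add_mem_box hX (hDs.smul η).neg hZ
  have hb : b ≤ b + d * (a / 2) := le_add_of_nonneg_right (by positivity)
  have hXb : X ∈ box d (a - a / 2) (b + d * (a / 2)) := box_mono (by linarith) hb hX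
  have hX'P := box_subset_PD ha' hX'b
  refine ⟨hX'P, ?_⟩
  rw [surrogate_optLik_eq hT hβ _ hYP, surrogate_optLik_eq hT hβ _ hYP]
  have h1 := hF.add_le _ hX'P X hXP
  rw [sub_sub_cancel, frobInner_smul_right] at h1
  have h2 := hΛL _ hX'b X hXb
  rw [sub_sub_cancel_left, frobNorm_neg, frobNorm_smul, abs_of_pos hη] at h2
  have h3 := (neg_le_abs _).trans (frobInner_le (optLikGradF S β (X - η • D) - optLikGradF S β X) D)
  have h4 : frobInner (optLikGradF S β (X - η • D)) D =
      frobInner (optLikGradF S β (X - η • D) - optLikGradF S β X) D +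
        frobInner (optLikGradH T β Y) D + frobNorm D ^ 2 := by
    rw [frobNorm_sq, ← frobInner_add_left, ← frobInner_add_left]
    congr 1
    rw [hD]
    abel
  have h5 : X - η • D - Y = (X - Y) - η • D := by abel
  rw [h5, frobInner_sub_right, frobInner_smul_right]
  have h6 : -frobInner (optLikGradF S β (X - η • D) - optLikGradF S β X) D ≤
      1 / 2 * frobNorm D ^ 2 := by
    refine h3.trans ((mul_le_mul_of_nonneg_right h2 hD0).trans ?_)
    have : Λ * η ≤ 1 / 2 := by nlinarith
    calc _ = (Λ * η) * frobNorm D ^ 2 := by ring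
      _ ≤ _ := mul_le_mul_of_nonneg_right this (sq_nonneg _)
  have h7 : η * (1 / 2 * frobNorm D ^ 2) ≤ η * (frobInner (optLikGradF S β (X - η • D)) D -
      frobInner (optLikGradH T β Y) D) :=
    mul_le_mul_of_nonneg_left (by linarith) hη.le
  linarith

lemma innerIter_succ (S T : Mat d) (β : ℝ) (η : ℕ → ℝ) (Y : Mat d) (l : ℕ) :
    innerIter S T β η Y (l + 1) = innerIter S T β η Y l -
      η l • (optLikGradF S β (innerIter S T β η Y l) - optLikGradH T β Y) := by
  rw [innerIter, optLikGradF, optLikGradH]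
  congr 2
  abel

/-- The inner loop decreases the surrogate at its starting point. -/
lemma innerIter_spec {ηmax : ℝ} {K : Set (Mat d)} {X₀ Y : Mat d} (hS : S.PosSemidef)
    (hT : T ∈ PD d) (hβ : 0 < β) (hK : sublevel (optLik S T β) X₀ ⊆ K)
    (hstep : ∀ X ∈ K, ∀ Y ∈ K, ∀ η : ℝ, 0 < η → η ≤ ηmax →
      X - η • (optLikGradF S β X - optLikGradH T β Y) ∈ PD d ∧
      surrogate (optLikF S T β) (optLikH T β)
        (X - η • (optLikGradF S β X - optLikGradH T β Y)) Y ≤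
      surrogate (optLikF S T β) (optLikH T β) X Y -
        η / 2 * frobNorm (optLikGradF S β X - optLikGradH T β Y) ^ 2)
    {η : ℕ → ℝ} (hη : ∀ l, 0 < η l ∧ η l ≤ ηmax) (hY : Y ∈ sublevel (optLik S T β) X₀) (l : ℕ) :
    innerIter S T β η Y l ∈ sublevel (optLik S T β) X₀ ∧
      surrogate (optLikF S T β) (optLikH T β) (innerIter S T β η Y l) Y ≤ optLik S T β Y ∧
      (1 ≤ l → optLik S T β (innerIter S T β η Y l) ≤ optLik S T β Y -
        η 0 / 2 * frobNorm (optLikGradF S β Y - optLikGradH T β Y) ^ 2) := by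
  have hdc := isDC_optLik hS hT hβ
  -- The induction runs on the surrogate at `Y`, the quantity each inner step decreases;
  -- majorization transfers the bound to the objective.
  suffices H : innerIter S T β η Y l ∈ sublevel (optLik S T β) X₀ ∧
      surrogate (optLikF S T β) (optLikH T β) (innerIter S T β η Y l) Y ≤ optLik S T β Y ∧
      (1 ≤ l → surrogate (optLikF S T β) (optLikH T β) (innerIter S T β η Y l) Y ≤
        optLik S T β Y - η 0 / 2 * frobNorm (optLikGradF S β Y - optLikGradH T β Y) ^ 2) from
    ⟨H.1, H.2.1, fun hl => (hdc.le_surrogate H.1.1 hY.1).trans (H.2.2 hl)⟩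
  induction l with
  | zero => exact ⟨hY, (hdc.surrogate_self hY.1).le, fun h => absurd h (by norm_num)⟩
  | succ l ih =>
    obtain ⟨hmem, hle, hdec⟩ := ih
    obtain ⟨hP, hs⟩ := hstep _ (hK hmem) Y (hK hY) (η l) (hη l).1 (hη l).2
    rw [← innerIter_succ] at hP hs
    have hpos : 0 ≤ η l / 2 * frobNorm (optLikGradF S β (innerIter S T β η Y l) -
        optLikGradH T β Y) ^ 2 := mul_nonneg (half_pos (hη l).1).le (sq_nonneg _)
    have hle' : surrogate (optLikF S T β) (optLikH T β) (innerIter S T β η Y (l + 1)) Y ≤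
        optLik S T β Y := by linarith
    refine ⟨⟨hP, (hdc.le_surrogate hP hY.1).trans (hle'.trans hY.2)⟩, hle', fun _ => ?_⟩
    -- The first step starts at `Y`, where its direction is the full gradient; later steps only
    -- preserve that decrease.
    rcases Nat.eq_zero_or_pos l with rfl | hl
    · have h0 := hdc.surrogate_self hY.1
      simp only [innerIter] at hs
      rw [h0] at hs
      exact hs
    · linarith [hdec hl]

/-- `u` is decreasing and bounded below, so its increments, which dominate `c * v k ^ 2`, tend to
zero. -/
lemma tendsto_zero_of_decrease {u v : ℕ → ℝ} {c m : ℝ} (hc : 0 < c) (hv : ∀ k, 0 ≤ v k)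
    (hm : ∀ k, m ≤ u k) (hu : ∀ k, u (k + 1) ≤ u k - c * v k ^ 2) : Tendsto v atTop (𝓝 0) := by
  have hanti : Antitone u := antitone_nat_of_succ_le fun k =>
    (hu k).trans (sub_le_self _ (mul_nonneg hc.le (sq_nonneg _)))
  have hlim := tendsto_atTop_ciInf hanti ⟨m, by rintro _ ⟨k, rfl⟩; exact hm k⟩
  have hdiff : Tendsto (fun k => (u k - u (k + 1)) / c) atTop (𝓝 0) := by
    simpa using (hlim.sub (hlim.comp (tendsto_add_atTop_nat 1))).div_const c
  have hsq : Tendsto (fun k => v k ^ 2) atTop (𝓝 0) :=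
    squeeze_zero (fun k => sq_nonneg _) (fun k => by
      rw [le_div_iff₀ hc]
      linarith [hu k]) hdiff
  have := hsq.sqrt
  simpa [Real.sqrt_sq (hv _)] using this

theorem exists_stepSize_tendsto (hS : S.PosSemidef) (hT : T ∈ PD d) (hβ : 0 < β) {X₀ Xs : Mat d}
    (hX₀ : X₀ ∈ PD d) {a b : ℝ} (ha : 0 < a) (hsub : sublevel (optLik S T β) X₀ ⊆ box d a b)
    (hXs : IsMinimizer (optLik S T β) Xs) :
    ∃ ηmax : ℝ, 0 < ηmax ∧ ∀ (L : ℕ) (η : ℕ → ℝ), 1 ≤ L → (∀ l, 0 < η l ∧ η l ≤ ηmax) →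
      ∀ l ≤ L, (∀ k, innerIter S T β η (outerIter S T β η L X₀ k) l ∈ PD d) ∧
        Tendsto (fun k => innerIter S T β η (outerIter S T β η L X₀ k) l) atTop (𝓝 Xs) := by
  have hdc := isDC_optLik hS hT hβ
  have hF := isSubgradient_optLikF hS hT hβ
  have hH := isSubgradient_optLikH hT hβ
  have hFl := (lipOnBoxes_optLikGradF S β).locLip
  have hHl := (lipOnBoxes_optLikGradH hT β).locLip
  -- The threshold depends only on the data and the box, hence is uniform in `L` and `η`.
  obtain ⟨ηmax, hηmax, hstep⟩ := exists_step_size hS hT hβ ha b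
  refine ⟨ηmax, hηmax, fun L η hL hη => ?_⟩
  set x : ℕ → Mat d := outerIter S T β η L X₀ with hx
  have hspec := fun (Y : Mat d) (hY : Y ∈ sublevel (optLik S T β) X₀) =>
    innerIter_spec hS hT hβ hsub hstep hη hY
  have hmem : ∀ k, x k ∈ sublevel (optLik S T β) X₀ := by
    intro k
    induction k with
    | zero => exact ⟨hX₀, le_rfl⟩
    | succ k ih => exact (hspec _ ih L).1
  have hgrad : Tendsto (fun k => frobNorm (optLikGradF S β (x k) - optLikGradH T β (x k)))
      atTop (𝓝 0) :=
    -- The constant `η 0 / 2` is the same for all outer iterations because the step sizes depend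
    -- only on the inner index.
    tendsto_zero_of_decrease (u := fun k => optLik S T β (x k)) (half_pos (hη 0).1)
      (fun k => frobNorm_nonneg _) (fun k => hXs.2 _ (hmem k).1)
      fun k => (hspec _ (hmem k) L).2.2 hL
  obtain ⟨R, hR⟩ := exists_riemDist_le_of_box hXs.1 ha b
  have hval : Tendsto (fun k => optLik S T β (x k)) atTop (𝓝 (optLik S T β Xs)) := by
    have h1 : Tendsto (fun k => optLik S T β Xs +
        frobNorm (optLikGradF S β (x k) - optLikGradH T β (x k)) * speedBound Xs R) atTop
        (𝓝 (optLik S T β Xs)) := by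
      simpa using (hgrad.mul_const (speedBound Xs R)).const_add (optLik S T β Xs)
    refine tendsto_of_tendsto_of_tendsto_of_le_of_le tendsto_const_nhds h1
      (fun k => hXs.2 _ (hmem k).1) fun k => ?_
    have := sub_le_frobNorm_grad_mul (gConvex_optLik hS hT hβ) hF hH hHl hdc.eq_sub (hmem k).1
      hXs.1 (hR _ (hsub (hmem k)))
    simp only
    linarith
  have hxlim : Tendsto x atTop (𝓝 Xs) :=
    tendsto_of_unique_minimizer hdc.continuousOn (isCompact_sublevel hdc.continuousOn ha hsub)
      (fun X hX => hX.1) hXs (fun Y hY => isMinimizer_optLik_unique hS hT hβ hY hXs) hmem hval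
  have hHlim := hHl.tendsto hXs.1 (fun k => (hmem k).1) hxlim
  -- By continuity the gradient vanishes at `Xs`, so inductively each inner step has displacement
  -- tending to zero and all inner iterates share the limit.
  have hcrit : optLikGradF S β Xs - optLikGradH T β Xs = 0 := by
    have h1 := (hFl.tendsto hXs.1 (fun k => (hmem k).1) hxlim).sub hHlim
    exact eq_zero_of_frobNorm_eq_zero
      (tendsto_nhds_unique ((continuous_frobNorm.tendsto _).comp h1) hgrad)
  have hP : ∀ l k, innerIter S T β η (x k) l ∈ PD d := fun l k => (hspec _ (hmem k) l).1.1
  intro l _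
  refine ⟨hP l, ?_⟩
  induction l with
  | zero => exact hxlim
  | succ l ih =>
    have ih := ih (by omega)
    have h1 := ih.sub (((hFl.tendsto hXs.1 (hP l) ih).sub hHlim).const_smul (η l))
    rw [hcrit, smul_zero, sub_zero] at h1
    simpa only [innerIter_succ] using h1

end GradientSteps

theorem optLik_convergence {S T X₀ : Mat d} {β : ℝ} (hS : S.PosSemidef) (hT : T ∈ PD d)
    (hX₀ : X₀ ∈ PD d) (hβ : 0 < β) (hor : S.PosDef ∨ 2 < β) :
    ∃ Xs, IsMinimizer (optLik S T β) Xs ∧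
      (∀ Y, IsMinimizer (optLik S T β) Y → Y = Xs) ∧
      (∃ X, IsCCCP (optLikF S T β) (optLikH T β) X₀ X) ∧
      (∀ X : ℕ → Mat d, IsCCCP (optLikF S T β) (optLikH T β) X₀ X →
        Tendsto X atTop (𝓝 Xs) ∧
        ∃ C : ℝ, ∀ k : ℕ, 1 ≤ k →
          optLik S T β (X k) - optLik S T β Xs ≤ C / (k + 2)) ∧
      (∃ ηmax : ℝ, 0 < ηmax ∧ ∀ (L : ℕ) (η : ℕ → ℝ), 1 ≤ L → (∀ l, 0 < η l ∧ η l ≤ ηmax) →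
        ∀ l ≤ L,
          (∀ k, innerIter S T β η (outerIter S T β η L X₀ k) l ∈ PD d) ∧
          Tendsto (fun k => innerIter S T β η (outerIter S T β η L X₀ k) l)
            atTop (𝓝 Xs)) := by
  have hdc := isDC_optLik hS hT hβ
  have hg := gConvex_optLik hS hT hβ
  obtain ⟨a, b, ha, hbox⟩ := exists_box_of_optLik_le hS hT hβ hor (optLik S T β X₀)
  have hsub : sublevel (optLik S T β) X₀ ⊆ box d a b := fun X hX => hbox X hX.1 hX.2
  have hcpt := isCompact_sublevel hdc.continuousOn ha hsub
  obtain ⟨B, hB⟩ := exists_riemDist_le_of_box hX₀ ha b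
  obtain ⟨⟨Xs, hXs⟩, hex, ⟨L, hL0, hL⟩, hseq⟩ :=
    cccp_convergence hg hdc hX₀ ⟨B, fun Y hY => hB Y (hsub hY)⟩
  have huniq : ∀ Y, IsMinimizer (optLik S T β) Y → Y = Xs :=
    fun Y hY => isMinimizer_optLik_unique hS hT hβ hY hXs
  obtain ⟨R, hR⟩ := exists_riemDist_le_of_box hXs.1 ha b
  refine ⟨Xs, hXs, huniq, hex, fun X hX => ⟨?_, _, fun k hk =>
    (hseq X hX).1 Xs R L hXs (fun Y hY => hR Y (hsub hY)) hL0 hL k hk⟩,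
    exists_stepSize_tendsto hS hT hβ hX₀ ha hsub hXs⟩
  exact tendsto_of_unique_minimizer hdc.continuousOn hcpt (fun X hX => hX.1) hXs huniq
    (hX.mem_sublevel hdc hX₀) (hX.tendsto hg hdc hX₀ hXs ha hsub)

end SPDCone

/-! ### The main theorem -/

open SPDCone Filter Topology in
theorem mainTheorem8 (d : ℕ) :
    -- convergence of the convex-concave procedure for g-convex DC regularized objectives
    (∃ α : Mat d → ℝ → ℝ, ∀ (φ Reg f h : Mat d → ℝ) (X₀ : Mat d),
      GConvex (regularized φ Reg) → IsDC (regularized φ Reg) f h → X₀ ∈ PD d →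
      (∃ B : ℝ, ∀ Y ∈ sublevel (regularized φ Reg) X₀, riemDist Y X₀ ≤ B) →
      (∃ Xs, IsMinimizer (regularized φ Reg) Xs) ∧
      (∃ X, IsCCCP f h X₀ X) ∧
      (∃ L : ℝ, 0 ≤ L ∧
        LipschitzGradOn h L (convexHull ℝ (sublevel (regularized φ Reg) X₀))) ∧
      ∀ X : ℕ → Mat d, IsCCCP f h X₀ X →
        (∀ (Xs : Mat d) (R L : ℝ), IsMinimizer (regularized φ Reg) Xs →
          (∀ Y ∈ sublevel (regularized φ Reg) X₀, riemDist Y Xs ≤ R) → 0 ≤ L →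
          LipschitzGradOn h L (convexHull ℝ (sublevel (regularized φ Reg) X₀)) →
          ∀ k : ℕ, 1 ≤ k →
            regularized φ Reg (X k) - regularized φ Reg Xs ≤ 2 * L * α Xs R ^ 2 / (k + 2)) ∧
        (∀ ε : ℝ, 0 < ε → ∀ᶠ k in atTop, ∃ Y, IsMinimizer (regularized φ Reg) Y ∧
          riemDist (X k) Y < ε)) ∧
    -- the S-divergence regularized Gaussian optimistic likelihood
    (∀ (S T X₀ : Mat d) (β : ℝ), S.PosSemidef → T ∈ PD d → X₀ ∈ PD d → 0 < β →
      (S.PosDef ∨ 2 < β) →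
      ∃ Xs, IsMinimizer (optLik S T β) Xs ∧
        (∀ Y, IsMinimizer (optLik S T β) Y → Y = Xs) ∧
        -- exact convex-concave procedure
        (∃ X, IsCCCP (optLikF S T β) (optLikH T β) X₀ X) ∧
        (∀ X : ℕ → Mat d, IsCCCP (optLikF S T β) (optLikH T β) X₀ X →
          Tendsto X atTop (𝓝 Xs) ∧
          ∃ C : ℝ, ∀ k : ℕ, 1 ≤ k →
            optLik S T β (X k) - optLik S T β Xs ≤ C / (k + 2)) ∧
        -- with the surrogate minimized by `L` gradient steps
        (∃ ηmax : ℝ, 0 < ηmax ∧ ∀ (L : ℕ) (η : ℕ → ℝ), 1 ≤ L → (∀ l, 0 < η l ∧ η l ≤ ηmax) →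
          ∀ l ≤ L,
            (∀ k, innerIter S T β η (outerIter S T β η L X₀ k) l ∈ PD d) ∧
            Tendsto (fun k => innerIter S T β η (outerIter S T β η L X₀ k) l)
              atTop (𝓝 Xs))) := by
  refine ⟨⟨fun Xs R => Real.sqrt 2 * speedBound Xs R, fun φ Reg f h X₀ hg hdc hX₀ hB =>
    cccp_convergence hg hdc hX₀ hB⟩, fun S T X₀ β hS hT hX₀ hβ hor =>
    optLik_convergence hS hT hX₀ hβ hor⟩
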